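/- Let $d\ge 1$, $l\ge 0$ and $s\in\{1,\dots,l+1\}$ be integers, let $p\in[1,+\infty]$ and let $\varrho>0$. For an open bounded connected nonempty set $U\subset\mathbb{R}^d$ of diameter $h_U$, let $W^{s,p}(U)$ be the space of functions on $U$ whose weak derivatives of order at most $s$ exist and belong to $L^p(U)$, with the seminorm $$|v|_{W^{s,p}(U)}=\sum_{\alpha\in\mathbb{N}^d,\ \alpha_1+\dots+\alpha_d=s}\|\partial^\alpha v\|_{L^p(U)},$$ and let $\mathbb{P}^l(U)$ be the space of polynomials in $d$ variables of total degree at most $l$ on $U$. The elliptic projector $\pi^l:W^{1,1}(U)\to\mathbb{P}^l(U)$ maps $v\in W^{1,1}(U)$ to the unique polynomial $\pi^l v\in\mathbb{P}^l(U)$ such that $$\int_U\nabla\pi^l v\cdot\nabla w=\int_U\nabla v\cdot\nabla w\quad\text{for all } w\in\mathbb{P}^l(U),\qquad \int_U(\pi^l v-v)=0.$$ Then there exists a real number $C>0$, depending only on $d$, $\varrho$, $l$, $s$ and $p$, such that for every open bounded connected nonempty set $U\subset\mathbb{R}^d$ that is star-shaped with respect to every point of some ball of radius $\varrho h_U$,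 the following holds: $\pi^l v$ is well defined (it exists and is unique) for every $v\in W^{1,1}(U)$, and, for every $v\in W^{s,p}(U)$, one has $v-\pi^l v\in W^{s,p}(U)$ and $$|v-\pi^l v|_{W^{m,p}(U)}\le C\,h_U^{s-m}\,|v|_{W^{s,p}(U)}\qquad\text{for all } m\in\{0,\dots,s\}.$$ -/

import Mathlib

open MeasureTheory
open scoped ENNReal ContDiff

noncomputable section

namespace EllipticProj

/-- The classical partial derivative `∂ᵢ f` on `ℝᵈ`. -/
def partialDeriv {d : ℕ} (i : Fin d) (f : EuclideanSpace ℝ (Fin d) → ℝ) :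
    EuclideanSpace ℝ (Fin d) → ℝ :=
  fun x => fderiv ℝ f x (EuclideanSpace.single i 1)

/-- The classical derivative `∂^α f = ∂₁^{α₁} ⋯ ∂_d^{α_d} f`, used for smooth `f` only. -/
def multiDeriv {d : ℕ} (α : Fin d → ℕ) (f : EuclideanSpace ℝ (Fin d) → ℝ) :
    EuclideanSpace ℝ (Fin d) → ℝ :=
  (List.finRange d).foldr (fun i g => (partialDeriv i)^[α i] g) f

/-- `g` is a weak derivative `∂^α v` of `v` in `U` (meant for open `U`). -/
structure HasWeakDeriv {d : ℕ} (U : Set (EuclideanSpace ℝ (Fin d))) (α : Fin d → ℕ)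
    (v g : EuclideanSpace ℝ (Fin d) → ℝ) : Prop where
  locallyIntegrableOn : LocallyIntegrableOn v U volume
  locallyIntegrableOn_deriv : LocallyIntegrableOn g U volume
  integral_eq : ∀ φ : EuclideanSpace ℝ (Fin d) → ℝ,
    ContDiff ℝ ∞ φ → HasCompactSupport φ → tsupport φ ⊆ U →
      ∫ x in U, v x * multiDeriv α φ x = (-1) ^ (∑ i, α i) * ∫ x in U, g x * φ x

open Classical in
/-- The weak derivative `∂^α v` in `U`; it is unique up to equality almost everywhere in `U`
(see `HasWeakDeriv.weakDeriv_ae_eq`). The value is `0` if there is no weak derivative. -/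
def weakDeriv {d : ℕ} (U : Set (EuclideanSpace ℝ (Fin d))) (α : Fin d → ℕ)
    (v : EuclideanSpace ℝ (Fin d) → ℝ) : EuclideanSpace ℝ (Fin d) → ℝ :=
  if h : ∃ g, HasWeakDeriv U α v g then h.choose else 0

/-- A weak derivative is unique up to equality almost everywhere in the open set `U`. -/
theorem HasWeakDeriv.weakDeriv_ae_eq {d : ℕ} {U : Set (EuclideanSpace ℝ (Fin d))}
    (hU : IsOpen U) {α : Fin d → ℕ} {v g : EuclideanSpace ℝ (Fin d) → ℝ}
    (h : HasWeakDeriv U α v g) : weakDeriv U α v =ᵐ[volume.restrict U] g := by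
  have hex : ∃ g, HasWeakDeriv U α v g := ⟨g, h⟩
  have hw : HasWeakDeriv U α v (weakDeriv U α v) := by
    unfold weakDeriv
    rw [dif_pos hex]
    exact hex.choose_spec
  generalize weakDeriv U α v = k at hw
  have key : ∀ᵐ x ∂(volume : Measure (EuclideanSpace ℝ (Fin d))), x ∈ U → (k - g) x = 0 := by
    refine hU.ae_eq_zero_of_integral_contDiff_smul_eq_zero
      (hw.locallyIntegrableOn_deriv.sub h.locallyIntegrableOn_deriv) ?_
    intro φ hφ hc hs
    have e := (hw.integral_eq φ hφ hc hs).symm.trans (h.integral_eq φ hφ hc hs)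
    have e' : ∫ x in U, k x * φ x = ∫ x in U, g x * φ x :=
      mul_left_cancel₀ (pow_ne_zero _ (by norm_num)) e
    have hint : ∀ f : EuclideanSpace ℝ (Fin d) → ℝ, LocallyIntegrableOn f U volume →
        Integrable (fun x => φ x * f x) volume := fun f hf => by
      rw [← integrableOn_iff_integrable_of_support_subset (s := tsupport φ)]
      · exact (hf.integrableOn_compact_subset hs hc).continuousOn_mul
          hφ.continuous.continuousOn hc
      · exact (Function.support_mul_subset_left _ _).trans (subset_tsupport φ)
    have hset : ∀ f : EuclideanSpace ℝ (Fin d) → ℝ,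
        ∫ x in U, f x * φ x = ∫ x, φ x * f x := fun f => by
      rw [setIntegral_eq_integral_of_forall_compl_eq_zero]
      · simp only [mul_comm]
      · intro x hx
        rw [image_eq_zero_of_notMem_tsupport (fun hx' => hx (hs hx')), mul_zero]
    rw [hset, hset] at e'
    simp only [Pi.sub_apply, smul_eq_mul, mul_sub]
    rw [integral_sub (hint _ hw.locallyIntegrableOn_deriv)
      (hint _ h.locallyIntegrableOn_deriv), e', sub_self]
  rw [Filter.EventuallyEq, ae_restrict_iff' hU.measurableSet]
  filter_upwards [key] with x hx hxU
  exact sub_eq_zero.mp (hx hxU)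

/-- `v ∈ W^{s,p}(U)`: all weak derivatives of order at most `s` exist and lie in `L^p(U)`. -/
def MemSobolev {d : ℕ} (U : Set (EuclideanSpace ℝ (Fin d))) (s : ℕ) (p : ℝ≥0∞)
    (v : EuclideanSpace ℝ (Fin d) → ℝ) : Prop :=
  ∀ α : Fin d → ℕ, ∑ i, α i ≤ s →
    ∃ g, HasWeakDeriv U α v g ∧ MemLp g p (volume.restrict U)

/-- The seminorm `|v|_{W^{s,p}(U)} = ∑_{|α| = s} ‖∂^α v‖_{L^p(U)}`. -/
def sobolevSeminorm {d : ℕ} (U : Set (EuclideanSpace ℝ (Fin d))) (s : ℕ) (p : ℝ≥0∞)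
    (v : EuclideanSpace ℝ (Fin d) → ℝ) : ℝ≥0∞ :=
  ∑ α ∈ Finset.piAntidiag (Finset.univ : Finset (Fin d)) s,
    eLpNorm (weakDeriv U α v) p (volume.restrict U)

/-- The function on `ℝᵈ` given by a polynomial in `d` variables. -/
def polyFun {d : ℕ} (q : MvPolynomial (Fin d) ℝ) : EuclideanSpace ℝ (Fin d) → ℝ :=
  fun x => MvPolynomial.eval (fun i => x i) q

/-- `q` is a polynomial of total degree at most `l` with
`∫_U ∇q · ∇w = ∫_U ∇v · ∇w` for all polynomials `w` of total degree at most `l`,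
and `∫_U (q - v) = 0`. -/
structure IsEllipticProjection {d : ℕ} (U : Set (EuclideanSpace ℝ (Fin d))) (l : ℕ)
    (v : EuclideanSpace ℝ (Fin d) → ℝ) (q : MvPolynomial (Fin d) ℝ) : Prop where
  totalDegree_le : q.totalDegree ≤ l
  integral_grad_eq : ∀ w : MvPolynomial (Fin d) ℝ, w.totalDegree ≤ l →
    ∫ x in U, ∑ i, polyFun (MvPolynomial.pderiv i q) x * polyFun (MvPolynomial.pderiv i w) x =
      ∫ x in U, ∑ i, weakDeriv U (Pi.single i 1) v x * polyFun (MvPolynomial.pderiv i w) x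
  integral_sub_eq_zero : ∫ x in U, (polyFun q x - v x) = 0

open Classical in
/-- The elliptic projector `π^l` onto the polynomials of degree at most `l`,
on functions `v ∈ W^{1,1}(U)` (for which the polynomial exists and is unique). -/
def ellipticProjector {d : ℕ} (U : Set (EuclideanSpace ℝ (Fin d))) (l : ℕ)
    (v : EuclideanSpace ℝ (Fin d) → ℝ) : MvPolynomial (Fin d) ℝ :=
  if h : ∃ q, IsEllipticProjection U l v q then h.choose else 0

end EllipticProj

end

/-! The proof compares the projector with a polynomial that matches means, and it rests on two
scale-invariant facts about sets star-shaped with respect to a ball `B` of radius `ϱ h`.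

Poincaré inequality. For `x ∈ U` and `z ∈ B` the segment `[z, x]` lies in `U`, so `|f x - f z|` is
at most `h` times the average of `∑ |∂ᵢ f|` along the segment. Take `L^p` norms in `(x, z)`, with
`z` averaged over `B`. The point `z + t (x - z)` has ratio `t` in `x` and `1 - t` in `z`; one of
these is at least `1/2`, so the change of variables costs at most `2 ^ d` (`map_segmentPoint_le`).
The constant is `2 ^ d (1 + |U| / |B|)`, and `|U| / |B| ≤ ϱ⁻¹ ^ d`. Mollification and Fatou's lemma
transfer this to weak derivatives (`eLpNorm_sub_prod_le`). Iteration bounds a function whose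
derivatives of order below `s` have zero mean by its seminorm of order `s`
(`exists_sobolevSeminorm_le`).

Stability of the projector. On polynomials of bounded degree all norms are equivalent, and rescaling
makes this uniform in `U` (`exists_sq_polyDeriv_le`). Testing the equation of `q = π^l w` with `q`
itself gives `‖∇q‖₂² ≤ ‖∇w‖₁ ‖∇q‖_∞`, and the sup norm is controlled by `|U|^(-1/2) ‖∇q‖₂`. Hence
the derivatives of `q` of order `m + 1` are bounded by `h ^ (-m)` times the mean of `|∇w|` over `U`,
and Hölder's inequality gives the `L^p` bound.

Conclusion. Choose `Q` of degree at most `s - 1 ≤ l` so that every derivative of `w = v - Q` of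
order below `s` has zero mean. Since `π^l` reproduces `Q`, `v - π^l v = w - π^l w`. For `m ≥ 1`,
Poincaré bounds `w`, while stability followed by Poincaré bounds `π^l w`. For `m = 0`, the function
`v - π^l v` has zero mean, so one more Poincaré inequality reduces to `m = 1`.

Well-posedness is finite-dimensional linear algebra: `∫ ∇q · ∇r + (∫ q) (∫ r)` is a definite form on
polynomials. -/

noncomputable section

namespace EllipticProj

/-! ### Words in commuting operators -/

section Iterates

variable {ι X : Type*} {T : ι → X → X} {S : Set X}

theorem iterate_mem_of_invariant (hS : ∀ i, ∀ x ∈ S, T i x ∈ S) (j : ι) (n : ℕ) :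
    ∀ x ∈ S, (T j)^[n] x ∈ S := by
  induction n with
  | zero => exact fun x hx => hx
  | succ n ih => exact fun x hx => ih _ (hS j x hx)

theorem iterate_comm_of_invariant (hS : ∀ i, ∀ x ∈ S, T i x ∈ S)
    (hT : ∀ i j, ∀ x ∈ S, T i (T j x) = T j (T i x)) (i j : ι) (n : ℕ) :
    ∀ x ∈ S, T i ((T j)^[n] x) = (T j)^[n] (T i x) := by
  induction n with
  | zero => exact fun x _ => rfl
  | succ n ih =>
    intro x hx
    rw [Function.iterate_succ_apply, Function.iterate_succ_apply, ih _ (hS j x hx), hT i j x hx]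

theorem foldr_iterate_mem (hS : ∀ i, ∀ x ∈ S, T i x ∈ S) (α : ι → ℕ) {x : X} (hx : x ∈ S)
    (L : List ι) : L.foldr (fun j g => (T j)^[α j] g) x ∈ S := by
  induction L with
  | nil => exact hx
  | cons j L ih => exact iterate_mem_of_invariant hS j _ _ ih

theorem foldr_iterate_comm (hS : ∀ i, ∀ x ∈ S, T i x ∈ S)
    (hT : ∀ i j, ∀ x ∈ S, T i (T j x) = T j (T i x)) (α : ι → ℕ) (i : ι) {x : X} (hx : x ∈ S)
    (L : List ι) :
    T i (L.foldr (fun j g => (T j)^[α j] g) x) = L.foldr (fun j g => (T j)^[α j] g) (T i x) := by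
  induction L with
  | nil => rfl
  | cons j L ih =>
    rw [List.foldr_cons, List.foldr_cons, ← ih]
    exact iterate_comm_of_invariant hS hT i j _ _ (foldr_iterate_mem hS α hx L)

/-- The additional `T i` is moved inwards through the operators that follow it; `Nodup` ensures that
it is counted once. Commutation is required on an invariant set only, because partial derivatives
commute on smooth functions but not on all functions. -/
theorem foldr_iterate_add_single [DecidableEq ι] (hS : ∀ i, ∀ x ∈ S, T i x ∈ S)
    (hT : ∀ i j, ∀ x ∈ S, T i (T j x) = T j (T i x)) (α : ι → ℕ) (i : ι) {x : X} (hx : x ∈ S)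
    {L : List ι} (hL : L.Nodup) :
    L.foldr (fun j g => (T j)^[(α + Pi.single i 1 : ι → ℕ) j] g) x =
      if i ∈ L then L.foldr (fun j g => (T j)^[α j] g) (T i x)
      else L.foldr (fun j g => (T j)^[α j] g) x := by
  induction L with
  | nil => rfl
  | cons j L ih =>
    rw [List.nodup_cons] at hL
    rw [List.foldr_cons, ih hL.2]
    rcases eq_or_ne i j with rfl | hij
    · rw [if_neg hL.1, if_pos List.mem_cons_self, List.foldr_cons,
        ← foldr_iterate_comm hS hT α i hx, ← Function.iterate_succ_apply]
      simp
    · simp only [List.mem_cons, hij, false_or, List.foldr_cons, Pi.add_apply, Pi.single_apply,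
        hij.symm, if_false, add_zero]
      split_ifs <;> rfl

end Iterates

/-! ### Classical derivatives, test functions and multi-indices -/

variable {d : ℕ}

theorem partialDeriv_contDiff (i : Fin d) {f : EuclideanSpace ℝ (Fin d) → ℝ}
    (hf : ContDiff ℝ ∞ f) : ContDiff ℝ ∞ (partialDeriv i f) := by
  unfold partialDeriv
  exact (hf.fderiv_right (m := ∞) (by simp)).clm_apply contDiff_const

theorem partialDeriv_comm (i j : Fin d) {f : EuclideanSpace ℝ (Fin d) → ℝ}
    (hf : ContDiff ℝ ∞ f) :
    partialDeriv i (partialDeriv j f) = partialDeriv j (partialDeriv i f) := by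
  have hd : Differentiable ℝ (fderiv ℝ f) :=
    (hf.fderiv_right (m := ∞) (by simp)).differentiable (by simp)
  have key : ∀ (i j : Fin d) (x : EuclideanSpace ℝ (Fin d)),
      partialDeriv i (partialDeriv j f) x =
        fderiv ℝ (fderiv ℝ f) x (EuclideanSpace.single i 1) (EuclideanSpace.single j 1) := by
    intro i j x
    unfold partialDeriv
    rw [fderiv_clm_apply (hd x) (differentiableAt_const _)]
    simp
  ext x
  rw [key, key]
  exact (hf.contDiffAt.isSymmSndFDerivAt
    (by simpa using WithTop.coe_le_coe.mpr (le_top : (2 : ℕ∞) ≤ ⊤))).eq _ _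

theorem partialDeriv_tsupport_subset (i : Fin d) (f : EuclideanSpace ℝ (Fin d) → ℝ) :
    tsupport (partialDeriv i f) ⊆ tsupport f := by
  refine closure_minimal (fun x hx => ?_) (isClosed_tsupport f)
  refine support_fderiv_subset ℝ (f := f) ?_
  intro h
  exact hx (by simp [partialDeriv, h])

/-- Smooth functions with compact support in `U`. -/
def testFunctions (U : Set (EuclideanSpace ℝ (Fin d))) : Set (EuclideanSpace ℝ (Fin d) → ℝ) :=
  {φ | ContDiff ℝ ∞ φ ∧ HasCompactSupport φ ∧ tsupport φ ⊆ U}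

theorem partialDeriv_mem_testFunctions {U : Set (EuclideanSpace ℝ (Fin d))} (i : Fin d) :
    ∀ φ ∈ testFunctions U, partialDeriv i φ ∈ testFunctions U := fun φ hφ =>
  ⟨partialDeriv_contDiff i hφ.1,
    hφ.2.1.of_isClosed_subset (isClosed_tsupport _) (partialDeriv_tsupport_subset i φ),
    (partialDeriv_tsupport_subset i φ).trans hφ.2.2⟩

theorem multiDeriv_mem_testFunctions {U : Set (EuclideanSpace ℝ (Fin d))} (α : Fin d → ℕ)
    {φ : EuclideanSpace ℝ (Fin d) → ℝ} (hφ : φ ∈ testFunctions U) :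
    multiDeriv α φ ∈ testFunctions U :=
  foldr_iterate_mem partialDeriv_mem_testFunctions α hφ _

/-- With the new derivative innermost, it can be absorbed into the test function; this is how weak
derivatives are chained below. -/
theorem multiDeriv_add_single (α : Fin d → ℕ) (i : Fin d) {φ : EuclideanSpace ℝ (Fin d) → ℝ}
    (hφ : ContDiff ℝ ∞ φ) :
    multiDeriv (α + Pi.single i 1) φ = multiDeriv α (partialDeriv i φ) := by
  have h := foldr_iterate_add_single (T := partialDeriv (d := d)) (S := {f | ContDiff ℝ ∞ f})
    (fun i f hf => partialDeriv_contDiff i hf) (fun i j f hf => partialDeriv_comm i j hf) α i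
    (show φ ∈ {f | ContDiff ℝ ∞ f} from hφ) (List.nodup_finRange d)
  rw [if_pos (List.mem_finRange i)] at h
  exact h

@[simp] theorem multiDeriv_zero (φ : EuclideanSpace ℝ (Fin d) → ℝ) : multiDeriv 0 φ = φ := by
  unfold multiDeriv
  induction List.finRange d with
  | nil => rfl
  | cons j L ih => simp

theorem multiDeriv_single (i : Fin d) {φ : EuclideanSpace ℝ (Fin d) → ℝ}
    (hφ : ContDiff ℝ ∞ φ) : multiDeriv (Pi.single i 1) φ = partialDeriv i φ := by
  have h := multiDeriv_add_single 0 i hφ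
  rwa [zero_add, multiDeriv_zero] at h

/-- Induction on multi-indices. -/
theorem multiIndex_induction {P : (Fin d → ℕ) → Prop} (h0 : P 0)
    (h1 : ∀ α i, P α → P (α + Pi.single i 1)) (α : Fin d → ℕ) : P α := by
  induction hn : ∑ i, α i generalizing α with
  | zero =>
    have : α = 0 := by
      ext i
      simpa using (Finset.sum_eq_zero_iff.mp hn) i (Finset.mem_univ i)
    rwa [this]
  | succ n ih =>
    obtain ⟨i, hi⟩ : ∃ i, α i ≠ 0 := by
      by_contra! h
      simp [h] at hn
    have hα : α = (α - Pi.single i 1) + Pi.single i 1 := by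
      ext j
      rcases eq_or_ne j i with rfl | hj
      · simp; omega
      · simp [hj]
    rw [hα]
    refine h1 _ _ (ih _ ?_)
    rw [hα] at hn
    simp only [Pi.add_apply, Finset.sum_add_distrib, Finset.sum_pi_single', Finset.mem_univ,
      if_true] at hn
    omega

theorem sum_add_single (α : Fin d → ℕ) (i : Fin d) :
    ∑ j, (α + Pi.single i 1 : Fin d → ℕ) j = ∑ j, α j + 1 := by
  simp [Finset.sum_add_distrib]

/-! ### Calculus of weak derivatives -/

section WeakDeriv

variable {U : Set (EuclideanSpace ℝ (Fin d))} {α : Fin d → ℕ} {i : Fin d}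
  {v v' g g' : EuclideanSpace ℝ (Fin d) → ℝ}

theorem integrableOn_mul_testFunction (hv : LocallyIntegrableOn v U volume)
    {φ : EuclideanSpace ℝ (Fin d) → ℝ} (hφ : φ ∈ testFunctions U) :
    IntegrableOn (fun x => v x * φ x) U volume := by
  have : Integrable (fun x => φ x * v x) volume := by
    rw [← integrableOn_iff_integrable_of_support_subset (s := tsupport φ)]
    · exact (hv.integrableOn_compact_subset hφ.2.2 hφ.2.1).continuousOn_mul
        hφ.1.continuous.continuousOn hφ.2.1
    · exact (Function.support_mul_subset_left _ _).trans (subset_tsupport φ)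
  simpa only [mul_comm] using this.integrableOn

theorem HasWeakDeriv.sub (h : HasWeakDeriv U α v g) (h' : HasWeakDeriv U α v' g') :
    HasWeakDeriv U α (v - v') (g - g') := by
  refine ⟨h.1.sub h'.1, h.2.sub h'.2, fun φ hφ hc hs => ?_⟩
  have hφ' : φ ∈ testFunctions U := ⟨hφ, hc, hs⟩
  simp only [Pi.sub_apply, sub_mul]
  rw [integral_sub (integrableOn_mul_testFunction h.1 (multiDeriv_mem_testFunctions α hφ'))
    (integrableOn_mul_testFunction h'.1 (multiDeriv_mem_testFunctions α hφ')),
    integral_sub (integrableOn_mul_testFunction h.2 hφ') (integrableOn_mul_testFunction h'.2 hφ'),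
    h.3 φ hφ hc hs, h'.3 φ hφ hc hs, mul_sub]

theorem hasWeakDeriv_zero (hv : LocallyIntegrableOn v U volume) : HasWeakDeriv U 0 v v :=
  ⟨hv, hv, fun φ _ _ _ => by simp⟩

/-- Apply the identity for `α` to the test function `∂ᵢ φ`: both hypotheses then evaluate the same
integral of `v`, and the common sign `(-1) ^ |α|` cancels. This makes a first-order inequality
applicable to every derivative of `v`. -/
theorem HasWeakDeriv.of_add_single (h : HasWeakDeriv U α v g)
    (h' : HasWeakDeriv U (α + Pi.single i 1) v g') : HasWeakDeriv U (Pi.single i 1) g g' := by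
  refine ⟨h.2, h'.2, fun φ hφ hc hs => ?_⟩
  have hφ' := partialDeriv_mem_testFunctions i φ ⟨hφ, hc, hs⟩
  have e := h.3 _ hφ'.1 hφ'.2.1 hφ'.2.2
  have e' := h'.3 φ hφ hc hs
  rw [multiDeriv_add_single α i hφ, e, sum_add_single, pow_succ, mul_assoc] at e'
  rw [multiDeriv_single i hφ, mul_left_cancel₀ (pow_ne_zero _ (by norm_num)) e']
  simp

theorem HasWeakDeriv.add_single (h : HasWeakDeriv U α v g)
    (h' : HasWeakDeriv U (Pi.single i 1) g g') : HasWeakDeriv U (α + Pi.single i 1) v g' := by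
  refine ⟨h.1, h'.2, fun φ hφ hc hs => ?_⟩
  have hφ' := partialDeriv_mem_testFunctions i φ ⟨hφ, hc, hs⟩
  have e := h.3 _ hφ'.1 hφ'.2.1 hφ'.2.2
  have e' := h'.3 φ hφ hc hs
  rw [multiDeriv_single i hφ] at e'
  rw [multiDeriv_add_single α i hφ, e, e', sum_add_single, pow_succ, mul_assoc]
  simp

theorem hasWeakDeriv_weakDeriv (h : ∃ g, HasWeakDeriv U α v g) :
    HasWeakDeriv U α v (weakDeriv U α v) := by
  unfold weakDeriv
  rw [dif_pos h]
  exact h.choose_spec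

end WeakDeriv

/-! ### Polynomials and their derivatives -/

section Polynomials

theorem polyFun_contDiff (q : MvPolynomial (Fin d) ℝ) : ContDiff ℝ ∞ (polyFun q) := by
  induction q using MvPolynomial.induction_on with
  | C a =>
    have : polyFun (MvPolynomial.C a : MvPolynomial (Fin d) ℝ) = fun _ => a := by
      ext x; simp [polyFun]
    rw [this]; exact contDiff_const
  | add p q hp hq =>
    have : polyFun (p + q) = fun x => polyFun p x + polyFun q x := by ext x; simp [polyFun]
    rw [this]; exact hp.add hq
  | mul_X p i hp =>
    have : polyFun (p * MvPolynomial.X i) = fun x => polyFun p x * x i := by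
      ext x; simp [polyFun]
    rw [this]
    exact hp.mul (EuclideanSpace.proj i : EuclideanSpace ℝ (Fin d) →L[ℝ] ℝ).contDiff

theorem partialDeriv_polyFun (i : Fin d) (q : MvPolynomial (Fin d) ℝ) :
    partialDeriv i (polyFun q) = polyFun (MvPolynomial.pderiv i q) := by
  have hdiff : ∀ q : MvPolynomial (Fin d) ℝ, Differentiable ℝ (polyFun q) := fun q =>
    (polyFun_contDiff q).differentiable (by simp)
  induction q using MvPolynomial.induction_on with
  | C a =>
    ext x
    have : polyFun (MvPolynomial.C a : MvPolynomial (Fin d) ℝ) = fun _ => a := by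
      ext x; simp [polyFun]
    simp [partialDeriv, this]
    simp [polyFun]
  | add p q hp hq =>
    have : polyFun (p + q) = polyFun p + polyFun q := by ext x; simp [polyFun]
    ext x
    have hp' := congrFun hp x
    have hq' := congrFun hq x
    simp only [partialDeriv] at hp' hq' ⊢
    rw [this, fderiv_add (hdiff p x) (hdiff q x), add_apply, hp', hq']
    simp [polyFun]
  | mul_X p j hp =>
    have : polyFun (p * MvPolynomial.X j) =
        polyFun p * ⇑(EuclideanSpace.proj j : EuclideanSpace ℝ (Fin d) →L[ℝ] ℝ) := by
      ext x; simp [polyFun]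
    ext x
    have hp' := congrFun hp x
    simp only [partialDeriv] at hp' ⊢
    rw [this, fderiv_mul (hdiff p x) (ContinuousLinearMap.differentiableAt _),
      ContinuousLinearMap.fderiv]
    simp only [add_apply, smul_apply, hp']
    rcases eq_or_ne j i with rfl | hij
    · simp [polyFun]
    · simp [polyFun, hij]

@[fun_prop] theorem polyFun_continuous (q : MvPolynomial (Fin d) ℝ) : Continuous (polyFun q) :=
  (polyFun_contDiff q).continuous

@[simp] theorem polyFun_add (q r : MvPolynomial (Fin d) ℝ) :
    polyFun (q + r) = polyFun q + polyFun r := by ext x; simp [polyFun]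

@[simp] theorem polyFun_sub (q r : MvPolynomial (Fin d) ℝ) :
    polyFun (q - r) = polyFun q - polyFun r := by ext x; simp [polyFun]

@[simp] theorem polyFun_smul (c : ℝ) (q : MvPolynomial (Fin d) ℝ) :
    polyFun (c • q) = c • polyFun q := by ext x; simp [polyFun]

@[simp] theorem polyFun_zero : polyFun (0 : MvPolynomial (Fin d) ℝ) = 0 := by
  ext x; simp [polyFun]

@[simp] theorem polyFun_C (c : ℝ) (x : EuclideanSpace ℝ (Fin d)) :
    polyFun (MvPolynomial.C c : MvPolynomial (Fin d) ℝ) x = c := by simp [polyFun]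

/-- The derivative `∂^α q` of a polynomial. -/
def polyDeriv (α : Fin d → ℕ) (q : MvPolynomial (Fin d) ℝ) : MvPolynomial (Fin d) ℝ :=
  (List.finRange d).foldr (fun i g => (MvPolynomial.pderiv i)^[α i] g) q

/-- Symmetry of second derivatives of smooth functions carries over, since a real polynomial is
determined by its values. -/
theorem pderiv_comm (i j : Fin d) (q : MvPolynomial (Fin d) ℝ) :
    MvPolynomial.pderiv i (MvPolynomial.pderiv j q) =
      MvPolynomial.pderiv j (MvPolynomial.pderiv i q) := by
  apply MvPolynomial.funext
  intro x
  have h := congrFun (partialDeriv_comm i j (polyFun_contDiff q)) (WithLp.toLp 2 x)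
  simp only [partialDeriv_polyFun] at h
  exact h

@[simp] theorem polyDeriv_zero (q : MvPolynomial (Fin d) ℝ) : polyDeriv 0 q = q := by
  unfold polyDeriv
  induction List.finRange d with
  | nil => rfl
  | cons j L ih => simp

theorem polyDeriv_add_single (α : Fin d → ℕ) (i : Fin d) (q : MvPolynomial (Fin d) ℝ) :
    polyDeriv (α + Pi.single i 1) q = polyDeriv α (MvPolynomial.pderiv i q) := by
  have h := foldr_iterate_add_single (T := fun i : Fin d => (MvPolynomial.pderiv (R := ℝ) i :
      MvPolynomial (Fin d) ℝ → MvPolynomial (Fin d) ℝ)) (S := Set.univ)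
    (fun _ _ _ => trivial) (fun i j f _ => pderiv_comm i j f) α i
    (Set.mem_univ q) (List.nodup_finRange d)
  rw [if_pos (List.mem_finRange i)] at h
  exact h

theorem pderiv_polyDeriv (α : Fin d → ℕ) (i : Fin d) (q : MvPolynomial (Fin d) ℝ) :
    MvPolynomial.pderiv i (polyDeriv α q) = polyDeriv α (MvPolynomial.pderiv i q) :=
  foldr_iterate_comm (T := fun i : Fin d => (MvPolynomial.pderiv (R := ℝ) i :
      MvPolynomial (Fin d) ℝ → MvPolynomial (Fin d) ℝ)) (S := Set.univ)
    (fun _ _ _ => trivial) (fun i j f _ => pderiv_comm i j f) α i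
    (Set.mem_univ q) (List.finRange d)

theorem polyDeriv_add (α : Fin d → ℕ) (q r : MvPolynomial (Fin d) ℝ) :
    polyDeriv α (q + r) = polyDeriv α q + polyDeriv α r := by
  induction α using multiIndex_induction generalizing q r with
  | h0 => simp
  | h1 α i ih => simp only [polyDeriv_add_single, map_add, ih]

/-- The truncated subtraction in the exponent is harmless: as soon as `α i > s i` for some `i`, a
falling factorial vanishes and so does the coefficient. -/
theorem polyDeriv_monomial (α : Fin d → ℕ) (s : Fin d →₀ ℕ) (a : ℝ) :
    polyDeriv α (MvPolynomial.monomial s a) =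
      MvPolynomial.monomial (s - Finsupp.equivFunOnFinite.symm α)
        (a * ∏ i, ((s i).descFactorial (α i) : ℝ)) := by
  induction α using multiIndex_induction generalizing s a with
  | h0 =>
    have : Finsupp.equivFunOnFinite.symm (0 : Fin d → ℕ) = 0 := by ext; simp
    simp [this]
  | h1 α i ih =>
    rw [polyDeriv_add_single, MvPolynomial.pderiv_monomial, ih]
    refine congrArg₂ (fun t b => MvPolynomial.monomial t b) ?_ ?_
    · ext j
      rcases eq_or_ne j i with rfl | hj
      · simp; omega
      · simp [hj]
    · rw [mul_assoc]
      congr 1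
      rw [← Finset.mul_prod_erase _ _ (Finset.mem_univ i),
        ← Finset.mul_prod_erase Finset.univ (fun j => ((s j).descFactorial _ : ℝ))
          (Finset.mem_univ i), ← mul_assoc]
      congr 1
      · rcases h : s i with _ | n
        · simp
        · simp [h, Nat.succ_descFactorial_succ, -Nat.descFactorial_succ]
      · refine Finset.prod_congr rfl fun j hj => ?_
        simp [(Finset.mem_erase.mp hj).1]

theorem integral_mul_partialDeriv {f φ : EuclideanSpace ℝ (Fin d) → ℝ} (hf : ContDiff ℝ ∞ f)
    (hφ : ContDiff ℝ ∞ φ) (hc : HasCompactSupport φ) (i : Fin d) :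
    ∫ x, f x * partialDeriv i φ x = -∫ x, partialDeriv i f x * φ x := by
  have hφ' := partialDeriv_mem_testFunctions i φ ⟨hφ, hc, Set.subset_univ _⟩
  have hint : ∀ f φ : EuclideanSpace ℝ (Fin d) → ℝ, Continuous f → Continuous φ →
      HasCompactSupport φ → Integrable (fun x => f x * φ x) := fun f φ hf hφ hc =>
    (hf.mul hφ).integrable_of_hasCompactSupport hc.mul_left
  exact integral_mul_fderiv_eq_neg_fderiv_mul_of_integrable
    (hint _ _ (partialDeriv_contDiff i hf).continuous hφ.continuous hc)
    (hint _ _ hf.continuous hφ'.1.continuous hφ'.2.1)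
    (hint _ _ hf.continuous hφ.continuous hc)
    (fun x _ => (hf.differentiable (by simp)) x) (fun x _ => (hφ.differentiable (by simp)) x)

theorem setIntegral_mul_testFunction {U : Set (EuclideanSpace ℝ (Fin d))}
    (f : EuclideanSpace ℝ (Fin d) → ℝ) {φ : EuclideanSpace ℝ (Fin d) → ℝ}
    (hs : tsupport φ ⊆ U) : ∫ x in U, f x * φ x = ∫ x, f x * φ x := by
  rw [setIntegral_eq_integral_of_forall_compl_eq_zero]
  intro x hx
  rw [image_eq_zero_of_notMem_tsupport (fun hx' => hx (hs hx')), mul_zero]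

theorem hasWeakDeriv_single_of_contDiff (U : Set (EuclideanSpace ℝ (Fin d)))
    {f : EuclideanSpace ℝ (Fin d) → ℝ} (hf : ContDiff ℝ ∞ f) (i : Fin d) :
    HasWeakDeriv U (Pi.single i 1) f (partialDeriv i f) := by
  refine ⟨hf.continuous.locallyIntegrable.locallyIntegrableOn U,
    (partialDeriv_contDiff i hf).continuous.locallyIntegrable.locallyIntegrableOn U,
    fun φ hφ hc hs => ?_⟩
  have hφ' := partialDeriv_mem_testFunctions i φ ⟨hφ, hc, hs⟩
  rw [multiDeriv_single i hφ, setIntegral_mul_testFunction f hφ'.2.2,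
    setIntegral_mul_testFunction _ hs, integral_mul_partialDeriv hf hφ hc]
  simp

theorem hasWeakDeriv_polyFun (U : Set (EuclideanSpace ℝ (Fin d))) (α : Fin d → ℕ)
    (q : MvPolynomial (Fin d) ℝ) : HasWeakDeriv U α (polyFun q) (polyFun (polyDeriv α q)) := by
  induction α using multiIndex_induction with
  | h0 =>
    rw [polyDeriv_zero]
    exact hasWeakDeriv_zero ((polyFun_continuous q).locallyIntegrable.locallyIntegrableOn U)
  | h1 α i ih =>
    rw [polyDeriv_add_single, ← pderiv_polyDeriv, ← partialDeriv_polyFun]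
    exact ih.add_single (hasWeakDeriv_single_of_contDiff U (polyFun_contDiff _) i)

end Polynomials

/-! ### `L^p` bounds for averages -/

section Averages

/-- Jensen's inequality in the probability variable `y`, then Tonelli; for `p = ⊤` the essential
bound on the product holds on almost every slice. -/
theorem eLpNorm_lintegral_le {α β : Type*} [MeasurableSpace α] [MeasurableSpace β]
    {μ : Measure α} {ν : Measure β} [SFinite μ] [IsProbabilityMeasure ν] {p : ℝ≥0∞} (hp : 1 ≤ p)
    {G : α × β → ℝ≥0∞} (hG : AEMeasurable G (μ.prod ν)) :
    eLpNorm (fun x => ∫⁻ y, G (x, y) ∂ν) p μ ≤ eLpNorm G p (μ.prod ν) := by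
  rcases eq_or_ne p ⊤ with rfl | hp'
  · rw [eLpNorm_exponent_top, eLpNorm_exponent_top]
    refine essSup_le_of_ae_le _ ?_
    have h := Measure.ae_ae_of_ae_prod (ae_le_eLpNormEssSup (f := G) (μ := μ.prod ν))
    filter_upwards [h] with x hx
    calc ‖∫⁻ y, G (x, y) ∂ν‖ₑ ≤ ∫⁻ _, eLpNormEssSup G (μ.prod ν) ∂ν := lintegral_mono_ae hx
      _ = _ := by simp
  · have hp0 : p ≠ 0 := (zero_lt_one.trans_le hp).ne'
    rw [eLpNorm_eq_lintegral_rpow_enorm_toReal hp0 hp',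
      eLpNorm_eq_lintegral_rpow_enorm_toReal hp0 hp']
    refine ENNReal.rpow_le_rpow ?_ (by positivity)
    rw [lintegral_prod _ (by simpa using hG.pow_const _)]
    refine lintegral_mono_ae ?_
    filter_upwards [hG.aestronglyMeasurable.prodMk_left] with x hx
    have h := eLpNorm_le_eLpNorm_of_exponent_le hp hx
    rw [eLpNorm_one_eq_lintegral_enorm, eLpNorm_eq_lintegral_rpow_enorm_toReal hp0 hp'] at h
    have hpos : 0 < p.toReal := ENNReal.toReal_pos hp0 hp'
    calc _ ≤ ((∫⁻ y, ‖G (x, y)‖ₑ ^ p.toReal ∂ν) ^ (1 / p.toReal)) ^ p.toReal :=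
          ENNReal.rpow_le_rpow h hpos.le
      _ = _ := by rw [← ENNReal.rpow_mul, one_div_mul_cancel hpos.ne', ENNReal.rpow_one]

/-- The point `z + t (x - z)` of the segment from `z` to `x`. -/
def segmentPoint {E : Type*} [NormedAddCommGroup E] [NormedSpace ℝ E] (w : (E × E) × ℝ) : E := w.1.2 + w.2 • (w.1.1 - w.1.2)

theorem continuous_segmentPoint {E : Type*} [NormedAddCommGroup E] [NormedSpace ℝ E] :
    Continuous (segmentPoint (E := E)) := by
  unfold segmentPoint; fun_prop

variable {E : Type*} [NormedAddCommGroup E] [NormedSpace ℝ E] [MeasurableSpace E] [BorelSpace E]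
  [FiniteDimensional ℝ E] {μ : Measure E} [μ.IsAddHaarMeasure]

open Module in
-- The preimage has measure `r⁻¹ ^ n * μ s`, with `n` the dimension, and `r⁻¹ ≤ 2`.
theorem addHaar_preimage_add_smul_le (c : E) {r : ℝ} (hr : 1 / 2 ≤ r) (s : Set E) :
    μ ((fun x => c + r • x) ⁻¹' s) ≤ 2 ^ finrank ℝ E * μ s := by
  have hr0 : 0 < r := by linarith
  have : (fun x : E => c + r • x) ⁻¹' s = (fun x => r • x) ⁻¹' ((fun x => c + x) ⁻¹' s) := rfl
  rw [this, Measure.addHaar_preimage_smul μ hr0.ne', measure_preimage_add]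
  gcongr
  rw [← ENNReal.ofReal_ofNat, ← ENNReal.ofReal_pow (by norm_num)]
  apply ENNReal.ofReal_le_ofReal
  rw [abs_of_pos (by positivity), ← inv_pow]
  gcongr
  rw [inv_le_comm₀ hr0 (by norm_num)]
  simpa using hr

open Module in
-- For `t ≥ 1/2` the segment point is integrated in `x` first, which costs `2 ^ n`, and averaging
-- over `B` costs nothing. For `t ≤ 1/2` it is integrated in `z` first, which costs `2 ^ n / μ B`,
-- and `x` then contributes `μ A`. The two cases avoid the degenerate Jacobian at `t = 0` or `t =
-- 1`.
theorem map_segmentPoint_le {A B : Set E} (hB0 : μ B ≠ 0) (hB : μ B ≠ ⊤) (hA : μ A ≠ ⊤) :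
    Measure.map segmentPoint
      (((μ.restrict A).prod ((μ B)⁻¹ • μ.restrict B)).prod (volume.restrict (Set.Ioc (0:ℝ) 1))) ≤
      (2 ^ finrank ℝ E * (1 + μ A / μ B)) • μ := by
  have : IsFiniteMeasure (μ.restrict A) := ⟨by simpa using hA.lt_top⟩
  have : IsFiniteMeasure (μ.restrict B) := ⟨by simpa using hB.lt_top⟩
  have : IsFiniteMeasure ((μ B)⁻¹ • μ.restrict B) :=
    Measure.smul_finite _ (ENNReal.inv_ne_top.mpr hB0)
  rw [Measure.le_iff]
  intro s hs
  have hm : MeasurableSet (segmentPoint ⁻¹' s) := continuous_segmentPoint.measurable hs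
  rw [Measure.map_apply continuous_segmentPoint.measurable hs, Measure.prod_apply_symm hm]
  have key : ∀ t ∈ Set.Ioc (0:ℝ) 1,
      ((μ.restrict A).prod ((μ B)⁻¹ • μ.restrict B)) ((fun w => (w, t)) ⁻¹' (segmentPoint ⁻¹' s)) ≤
        2 ^ finrank ℝ E * (1 + μ A / μ B) * μ s := by
    intro t ht
    have hmt : MeasurableSet ((fun w : E × E => (w, t)) ⁻¹' (segmentPoint ⁻¹' s)) :=
      (measurable_id.prodMk measurable_const) hm
    rcases le_total (1 / 2) t with h | h
    · rw [Measure.prod_apply_symm hmt]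
      calc _ ≤ ∫⁻ _, 2 ^ finrank ℝ E * μ s ∂((μ B)⁻¹ • μ.restrict B) := by
            refine lintegral_mono fun z => (Measure.restrict_apply_le _ _).trans ?_
            refine le_trans (measure_mono ?_) (addHaar_preimage_add_smul_le (z - t • z) h s)
            intro x hx
            simp only [Set.mem_preimage, segmentPoint] at hx ⊢
            convert! hx using 1
            module
        _ ≤ 2 ^ finrank ℝ E * 1 * μ s := by
            rw [lintegral_const]
            simp [ENNReal.inv_mul_cancel hB0 hB]
        _ ≤ _ := by gcongr; exact le_self_add
    · rw [Measure.prod_apply hmt]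
      calc _ ≤ ∫⁻ _ in A, (μ B)⁻¹ * (2 ^ finrank ℝ E * μ s) ∂μ := by
            refine lintegral_mono fun x => ?_
            rw [Measure.smul_apply, smul_eq_mul]
            gcongr
            refine (Measure.restrict_apply_le _ _).trans ?_
            refine le_trans (measure_mono ?_)
              (addHaar_preimage_add_smul_le (t • x) (by linarith : 1 / 2 ≤ 1 - t) s)
            intro z hz
            simp only [Set.mem_preimage, segmentPoint] at hz ⊢
            convert! hz using 1
            module
        _ = 2 ^ finrank ℝ E * (μ A / μ B) * μ s := by
            rw [setLIntegral_const, ENNReal.div_eq_inv_mul]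
            ring
        _ ≤ _ := by gcongr; exact le_add_self
  calc _ ≤ ∫⁻ _ in Set.Ioc (0:ℝ) 1, 2 ^ finrank ℝ E * (1 + μ A / μ B) * μ s :=
        setLIntegral_mono' measurableSet_Ioc key
    _ = _ := by simp

open Module in
theorem eLpNorm_segment_average_le {A B : Set E} (hB0 : μ B ≠ 0) (hB : μ B ≠ ⊤) (hA : μ A ≠ ⊤)
    {p : ℝ≥0∞} (hp : 1 ≤ p) {G : E → ℝ≥0∞} (hG : Measurable G) :
    eLpNorm (fun w : E × E => ∫⁻ t in Set.Ioc (0:ℝ) 1, G (segmentPoint (w, t))) p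
      ((μ.restrict A).prod ((μ B)⁻¹ • μ.restrict B)) ≤
      2 ^ finrank ℝ E * (1 + μ A / μ B) * eLpNorm G p μ := by
  have : IsFiniteMeasure (μ.restrict A) := ⟨by simpa using hA.lt_top⟩
  have : IsFiniteMeasure (μ.restrict B) := ⟨by simpa using hB.lt_top⟩
  have : IsFiniteMeasure ((μ B)⁻¹ • μ.restrict B) :=
    Measure.smul_finite _ (ENNReal.inv_ne_top.mpr hB0)
  have : IsProbabilityMeasure (volume.restrict (Set.Ioc (0:ℝ) 1)) := ⟨by simp⟩
  set M : ℝ≥0∞ := 2 ^ finrank ℝ E * (1 + μ A / μ B)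
  have hM : 1 ≤ M := one_le_mul (one_le_pow₀ (by norm_num)) le_self_add
  refine (eLpNorm_lintegral_le hp
    (hG.comp continuous_segmentPoint.measurable).aemeasurable).trans ?_
  rw [← eLpNorm_map_measure hG.aestronglyMeasurable continuous_segmentPoint.measurable.aemeasurable]
  refine (eLpNorm_mono_measure _ (map_segmentPoint_le hB0 hB hA)).trans ?_
  refine (eLpNorm_smul_measure_le _ _ _ _).trans ?_
  rw [smul_eq_mul]
  gcongr
  -- The change of measure produces `M ^ (1 / p)`; since `M ≥ 1` it is at most `M`, which does not
  -- depend on `p`.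
  refine (ENNReal.rpow_le_rpow_of_exponent_le hM ?_).trans (ENNReal.rpow_one M).le
  rw [one_div, ENNReal.toReal_inv]
  rcases eq_or_ne p ⊤ with rfl | hp'
  · simp
  · exact inv_le_one_of_one_le₀ (by simpa using ENNReal.toReal_mono hp' hp)

/-- Young's inequality for a kernel of mass one: the convolution is an average over the probability
measure of density `k`, and `(x, y) ↦ x - y` sends the product measure to `μ` by translation
invariance. -/
theorem eLpNorm_lconvolution_le {k : E → ℝ≥0∞} (hk : Measurable k) (hk1 : ∫⁻ y, k y ∂μ = 1)
    {p : ℝ≥0∞} (hp : 1 ≤ p) {G : E → ℝ≥0∞} (hG : AEMeasurable G μ) :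
    eLpNorm (fun x => ∫⁻ y, k y * G (x - y) ∂μ) p μ ≤ eLpNorm G p μ := by
  have : IsProbabilityMeasure (μ.withDensity k) := ⟨by simpa using hk1⟩
  have hms : Measurable (fun w : E × E => w.1 - w.2) := measurable_sub
  have hmap : Measure.map (fun w : E × E => w.1 - w.2) (μ.prod (μ.withDensity k)) = μ := by
    ext s hs
    rw [Measure.map_apply hms hs, Measure.prod_apply_symm (hms hs)]
    have : ∀ y : E, μ ((fun x => (x, y)) ⁻¹' ((fun w : E × E => w.1 - w.2) ⁻¹' s)) = μ s := by
      intro y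
      simp only [← Set.preimage_comp, Function.comp_def, sub_eq_add_neg]
      exact measure_preimage_add_right μ (-y) s
    simp [this]
  have hG' : AEMeasurable (fun w : E × E => G (w.1 - w.2)) (μ.prod (μ.withDensity k)) := by
    refine AEMeasurable.comp_aemeasurable (g := G) ?_ hms.aemeasurable
    rwa [hmap]
  have h := eLpNorm_lintegral_le hp hG'
  rw [show (fun w : E × E => G (w.1 - w.2)) = G ∘ (fun w : E × E => w.1 - w.2) from rfl,
    ← eLpNorm_map_measure (by rw [hmap]; exact hG.aestronglyMeasurable) hms.aemeasurable, hmap] at h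
  refine le_trans (le_of_eq ?_) h
  congr 1
  ext x
  have hx : AEMeasurable (fun y => G (x - y)) μ :=
    hG.comp_quasiMeasurePreserving (quasiMeasurePreserving_sub_left μ x)
  rw [lintegral_withDensity_eq_lintegral_mul₀ hk.aemeasurable hx]
  rfl

/-- Fatou's lemma. The index from which the bound holds depends on the point, so `F n` is first
replaced by zero where it exceeds `H n`; this does not affect the limit. -/
theorem eLpNorm_le_of_tendsto_of_eventually_enorm_le {α : Type*} [MeasurableSpace α]
    {μ : Measure α} {p : ℝ≥0∞} {F : ℕ → α → ℝ} {f : α → ℝ} {H : ℕ → α → ℝ≥0∞} {c : ℝ≥0∞}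
    (hF : ∀ n, Measurable (F n)) (hH : ∀ n, Measurable (H n))
    (hlim : ∀ᵐ x ∂μ, Filter.Tendsto (fun n => F n x) Filter.atTop (nhds (f x)))
    (hle : ∀ᵐ x ∂μ, ∀ᶠ n in Filter.atTop, ‖F n x‖ₑ ≤ H n x)
    (hc : ∀ n, eLpNorm (H n) p μ ≤ c) : eLpNorm f p μ ≤ c := by
  classical
  have hset : ∀ n, MeasurableSet {x | ‖F n x‖ₑ ≤ H n x} := fun n =>
    measurableSet_le (hF n).enorm (hH n)
  have h := Lp.eLpNorm_lim_le_liminf_eLpNorm (p := p) (μ := μ)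
    (f := fun n => {x | ‖F n x‖ₑ ≤ H n x}.indicator (F n))
    (fun n => ((hF n).indicator (hset n)).aestronglyMeasurable) f ?_
  · refine h.trans (Filter.liminf_le_of_le (by isBoundedDefault) fun b hb => ?_)
    obtain ⟨n, hn⟩ := hb.exists
    refine hn.trans (le_trans (eLpNorm_mono_enorm fun x => ?_) (hc n))
    by_cases hx : ‖F n x‖ₑ ≤ H n x
    · simp [Set.indicator, hx]
    · simp [Set.indicator, hx]
  · filter_upwards [hlim, hle] with x hx hx'
    refine hx.congr' ?_
    filter_upwards [hx'] with n hn
    simp [Set.indicator, hn]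

end Averages

/-! ### Mollification inside an open set -/

section Mollification

variable {U : Set (EuclideanSpace ℝ (Fin d))}

open scoped Convolution

/-- The mollification of `f`, restricted to `U` and extended by zero. -/
def mollify (U : Set (EuclideanSpace ℝ (Fin d))) (φ : ContDiffBump (0 : EuclideanSpace ℝ (Fin d)))
    (f : EuclideanSpace ℝ (Fin d) → ℝ) : EuclideanSpace ℝ (Fin d) → ℝ :=
  φ.normed volume ⋆[ContinuousLinearMap.lsmul ℝ ℝ, volume] (U.indicator f)

variable {φ : ContDiffBump (0 : EuclideanSpace ℝ (Fin d))} {f g : EuclideanSpace ℝ (Fin d) → ℝ}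

theorem mollify_contDiff (hU : MeasurableSet U) (φ : ContDiffBump (0 : EuclideanSpace ℝ (Fin d)))
    (hf : IntegrableOn f U) : ContDiff ℝ ∞ (mollify U φ f) :=
  φ.hasCompactSupport_normed.contDiff_convolution_left _ (n := ⊤) φ.contDiff_normed
    ((integrable_indicator_iff hU).mpr hf).locallyIntegrable

theorem mollify_eq_integral (hU : MeasurableSet U) (y : EuclideanSpace ℝ (Fin d)) :
    mollify U φ f y = ∫ u in U, f u * φ.normed volume (y - u) := by
  unfold mollify
  rw [convolution_eq_swap, ← integral_indicator hU]
  congr 1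
  ext u
  by_cases hu : u ∈ U <;> simp [hu, mul_comm]

theorem eLpNorm_mollify_le (hU : MeasurableSet U)
    (φ : ContDiffBump (0 : EuclideanSpace ℝ (Fin d))) (hf : IntegrableOn f U)
    {p : ℝ≥0∞} (hp : 1 ≤ p) : eLpNorm (mollify U φ f) p volume ≤ eLpNorm f p (volume.restrict U) := by
  have hfi := (integrable_indicator_iff hU).mpr hf
  have hk1 : ∫⁻ y, ‖φ.normed volume y‖ₑ = 1 := by
    have h := φ.integral_normed (μ := volume)
    rw [integral_eq_lintegral_of_nonneg_ae (Filter.Eventually.of_forall fun x => φ.nonneg_normed x)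
      φ.continuous_normed.aestronglyMeasurable] at h
    simp_rw [Real.enorm_eq_ofReal (φ.nonneg_normed _)]
    rwa [← ENNReal.toReal_eq_one_iff]
  have h := eLpNorm_lconvolution_le (φ.continuous_normed (μ := volume)).measurable.enorm hk1 hp
    hfi.aestronglyMeasurable.enorm
  refine (eLpNorm_mono_enorm (g := fun x => ∫⁻ y, ‖φ.normed volume y‖ₑ * ‖U.indicator f (x - y)‖ₑ)
    fun x => ?_).trans (h.trans (le_of_eq ?_))
  · refine (enorm_integral_le_lintegral_enorm _).trans (le_of_eq ?_)
    simp [enorm_mul]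
  · rw [eLpNorm_enorm, eLpNorm_indicator_eq_eLpNorm_restrict hU]

/-- When the ball around `y` stays in `U`, the function `u ↦ φ (y - u)` is an admissible test
function; the sign from its chain rule cancels the sign in the definition of the weak derivative. -/
theorem partialDeriv_mollify (hU : IsOpen U) {i : Fin d} (h : HasWeakDeriv U (Pi.single i 1) f g)
    (hf : IntegrableOn f U) {y : EuclideanSpace ℝ (Fin d)}
    (hy : Metric.closedBall y φ.rOut ⊆ U) :
    partialDeriv i (mollify U φ f) y = mollify U φ g y := by
  set ψ : EuclideanSpace ℝ (Fin d) → ℝ := fun u => φ.normed volume (y - u) with hψ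
  have hφc : ContDiff ℝ ∞ (φ.normed volume) := φ.contDiff_normed
  have hψc : ContDiff ℝ ∞ ψ := hφc.comp (contDiff_const.sub contDiff_id)
  have hsupp : tsupport ψ ⊆ Metric.closedBall y φ.rOut := by
    refine closure_minimal (fun u hu => ?_) Metric.isClosed_closedBall
    have : y - u ∈ Function.support (φ.normed volume) := hu
    rw [φ.support_normed_eq, Metric.mem_ball, dist_zero_right] at this
    rw [Metric.mem_closedBall, dist_comm, dist_eq_norm]
    exact this.le
  have hψk : HasCompactSupport ψ :=
    (isCompact_closedBall y φ.rOut).of_isClosed_subset (isClosed_tsupport _) hsupp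
  have hint := h.integral_eq ψ hψc hψk (hsupp.trans hy)
  have hpd : ∀ u, partialDeriv i ψ u = - fderiv ℝ (φ.normed volume) (y - u)
      (EuclideanSpace.single i 1) := by
    intro u
    have h1 : HasFDerivAt (φ.normed volume) (fderiv ℝ (φ.normed volume) (y - u)) (y - u) :=
      ((hφc.differentiable (by simp)) _).hasFDerivAt
    have h2 := h1.comp u ((hasFDerivAt_id u).const_sub y)
    have h3 : fderiv ℝ ψ u = _ := h2.fderiv
    simp [partialDeriv, h3]
  rw [multiDeriv_single i hψc] at hint
  rw [mollify_eq_integral hU.measurableSet]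
  have hfi := (integrable_indicator_iff hU.measurableSet).mpr hf
  have hd := φ.hasCompactSupport_normed.hasFDerivAt_convolution_left
    (ContinuousLinearMap.lsmul ℝ ℝ) (φ.contDiff_normed (μ := volume) (n := 1))
    hfi.locallyIntegrable y
  have hd' : fderiv ℝ (mollify U φ f) y = _ := hd.fderiv
  have hex : ConvolutionExistsAt (fderiv ℝ (φ.normed volume)) (U.indicator f) y
      ((ContinuousLinearMap.lsmul ℝ ℝ).precompL (EuclideanSpace ℝ (Fin d))) volume :=
    (φ.hasCompactSupport_normed.fderiv ℝ).convolutionExists_left _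
      (hφc.continuous_fderiv (by simp)) hfi.locallyIntegrable y
  rw [partialDeriv, hd', convolution_def, ContinuousLinearMap.integral_apply hex]
  simp only [ContinuousLinearMap.precompL_apply]
  rw [← integral_sub_left_eq_self _ volume y]
  simp only [sub_sub_cancel]
  have e : ∀ u, (ContinuousLinearMap.lsmul ℝ ℝ) ((fderiv ℝ (φ.normed volume) (y - u))
      (EuclideanSpace.single i 1)) (U.indicator f u) =
      U.indicator (fun u => -(f u * partialDeriv i ψ u)) u := by
    intro u
    by_cases hu : u ∈ U <;> simp [hu, hpd, mul_comm]
  simp only [e]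
  rw [integral_indicator hU.measurableSet, integral_neg, hint]
  simp [hψ]

/-- The fundamental theorem of calculus along the segment, each coordinate of `x - z` being at most
`dist x z` in absolute value. -/
theorem enorm_sub_le_lintegral_segment {F : EuclideanSpace ℝ (Fin d) → ℝ} (hF : ContDiff ℝ ∞ F)
    (x z : EuclideanSpace ℝ (Fin d)) :
    ‖F x - F z‖ₑ ≤ ∫⁻ t in Set.Ioc (0:ℝ) 1,
      ENNReal.ofReal (dist x z) * ∑ i, ‖partialDeriv i F (segmentPoint ((x, z), t))‖ₑ := by
  have hF1 : ∀ y, HasFDerivAt F (fderiv ℝ F y) y := fun y =>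
    ((hF.differentiable (by simp)) y).hasFDerivAt
  have hcont : Continuous (fun t : ℝ => fderiv ℝ F (segmentPoint ((x, z), t)) (x - z)) := by
    have h1 : Continuous (fderiv ℝ F) := hF.continuous_fderiv (by simp)
    have h2 : Continuous (fun t : ℝ => segmentPoint ((x, z), t)) :=
      continuous_segmentPoint.comp (by fun_prop)
    exact (h1.comp h2).clm_apply continuous_const
  have hderiv : ∀ t : ℝ, HasDerivAt (fun t : ℝ => F (segmentPoint ((x, z), t)))
      (fderiv ℝ F (segmentPoint ((x, z), t)) (x - z)) t := by
    intro t
    have hl : HasDerivAt (fun t : ℝ => segmentPoint ((x, z), t)) (x - z) t := by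
      simpa [segmentPoint] using ((hasDerivAt_id t).smul_const (x - z)).const_add z
    exact (hF1 _).comp_hasDerivAt t hl
  have hftc := intervalIntegral.integral_eq_sub_of_hasDerivAt (a := 0) (b := 1)
    (fun t _ => hderiv t) (hcont.intervalIntegrable 0 1)
  have e1 : segmentPoint ((x, z), (1:ℝ)) = x := by simp [segmentPoint]
  have e0 : segmentPoint ((x, z), (0:ℝ)) = z := by simp [segmentPoint]
  rw [e1, e0, intervalIntegral.integral_of_le zero_le_one] at hftc
  rw [← hftc]
  refine (enorm_integral_le_lintegral_enorm _).trans (lintegral_mono fun t => ?_)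
  set y := segmentPoint ((x, z), t)
  have hexp : fderiv ℝ F y (x - z) = ∑ i, (x - z) i * partialDeriv i F y := by
    conv_lhs => rw [← (EuclideanSpace.basisFun (Fin d) ℝ).sum_repr (x - z)]
    simp [partialDeriv, map_sum]
  rw [hexp, Finset.mul_sum]
  refine (enorm_sum_le _ _).trans (Finset.sum_le_sum fun i _ => ?_)
  rw [enorm_mul]
  gcongr
  rw [← ofReal_norm, dist_eq_norm]
  exact ENNReal.ofReal_le_ofReal (PiLp.norm_apply_le (x - z) i)

/-- A sequence of bump functions whose supports shrink to the origin. -/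
def shrinkingBump (d : ℕ) (n : ℕ) : ContDiffBump (0 : EuclideanSpace ℝ (Fin d)) where
  rIn := 1 / (n + 1) / 2
  rOut := 1 / (n + 1)
  rIn_pos := by positivity
  rIn_lt_rOut := half_lt_self (by positivity)

theorem tendsto_shrinkingBump_rOut :
    Filter.Tendsto (fun n => (shrinkingBump d n).rOut) Filter.atTop (nhds 0) :=
  tendsto_one_div_add_atTop_nhds_zero_nat

theorem ae_tendsto_mollify (hU : MeasurableSet U) (hf : IntegrableOn f U) :
    ∀ᵐ x ∂volume.restrict U,
      Filter.Tendsto (fun n => mollify U (shrinkingBump d n) f x) Filter.atTop (nhds (f x)) := by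
  have h := ContDiffBump.ae_convolution_tendsto_right_of_locallyIntegrable (K := 2)
    (φ := shrinkingBump d) (μ := volume) tendsto_shrinkingBump_rOut
    (Filter.Eventually.of_forall fun n => le_of_eq (by simp [shrinkingBump]; ring))
    ((integrable_indicator_iff hU).mpr hf).locallyIntegrable
  rw [ae_restrict_iff' hU]
  filter_upwards [h] with x hx hxU
  rwa [Set.indicator_of_mem hxU] at hx

/-! ### Poincaré inequalities -/

variable {G : Fin d → EuclideanSpace ℝ (Fin d) → ℝ}

/-- The Poincaré inequality in terms of differences, for a set that is star-shaped with respect to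
every point of `B`. -/
theorem eLpNorm_sub_prod_le (hU : IsOpen U) (hUfin : volume U ≠ ⊤)
    {B : Set (EuclideanSpace ℝ (Fin d))} (hB : MeasurableSet B) (hBU : B ⊆ U)
    (hB0 : volume B ≠ 0) (hstar : ∀ z ∈ B, StarConvex ℝ z U) {h : ℝ}
    (hdist : ∀ x ∈ U, ∀ z ∈ U, dist x z ≤ h) (hf : IntegrableOn f U)
    (hG : ∀ i, IntegrableOn (G i) U) (hfG : ∀ i, HasWeakDeriv U (Pi.single i 1) f (G i))
    {p : ℝ≥0∞} (hp : 1 ≤ p) :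
    eLpNorm (fun w : EuclideanSpace ℝ (Fin d) × EuclideanSpace ℝ (Fin d) => f w.1 - f w.2) p
      ((volume.restrict U).prod ((volume B)⁻¹ • volume.restrict B)) ≤
      2 ^ d * (1 + volume U / volume B) *
        (ENNReal.ofReal h * ∑ i, eLpNorm (G i) p (volume.restrict U)) := by
  have hBfin : volume B ≠ ⊤ := ((measure_mono hBU).trans_lt hUfin.lt_top).ne
  have hUm := hU.measurableSet
  have i1 : IsFiniteMeasure (volume.restrict U) := ⟨by simpa using hUfin.lt_top⟩
  have i2 : IsFiniteMeasure (volume.restrict B) := ⟨by simpa using hBfin.lt_top⟩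
  have i3 : IsFiniteMeasure ((volume B)⁻¹ • volume.restrict B) :=
    Measure.smul_finite _ (ENNReal.inv_ne_top.mpr hB0)
  have hac : (volume B)⁻¹ • volume.restrict B ≪ volume.restrict B :=
    Measure.smul_absolutelyContinuous
  have hcont : ∀ n, Continuous (mollify U (shrinkingBump d n) f) := fun n =>
    (mollify_contDiff hUm _ hf).continuous
  have hGcont : ∀ n i, Continuous (mollify U (shrinkingBump d n) (G i)) := fun n i =>
    (mollify_contDiff hUm _ (hG i)).continuous
  have hae := ae_tendsto_mollify hUm hf
  have hae' := hac.ae_le (ae_mono (Measure.restrict_mono hBU le_rfl) hae)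
  set P : ℕ → EuclideanSpace ℝ (Fin d) → ℝ≥0∞ := fun n y =>
    ENNReal.ofReal h * ∑ i, ‖mollify U (shrinkingBump d n) (G i) y‖ₑ with hP
  have hPm : ∀ n, Measurable (P n) := fun n => by
    refine Measurable.const_mul (Finset.measurable_sum _ fun i _ => ?_) _
    exact (hGcont n i).measurable.enorm
  refine eLpNorm_le_of_tendsto_of_eventually_enorm_le
    (F := fun n w => mollify U (shrinkingBump d n) f w.1 - mollify U (shrinkingBump d n) f w.2)
    (H := fun n w => ∫⁻ t in Set.Ioc (0:ℝ) 1, P n (segmentPoint (w, t))) ?_ ?_ ?_ ?_ ?_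
  · exact fun n => (((hcont n).comp continuous_fst).sub ((hcont n).comp continuous_snd)).measurable
  · exact fun n => Measurable.lintegral_prod_right'
      ((hPm n).comp continuous_segmentPoint.measurable)
  · have h1 := Measure.quasiMeasurePreserving_fst (μ := volume.restrict U)
      (ν := (volume B)⁻¹ • volume.restrict B) |>.ae hae
    have h2 := Measure.quasiMeasurePreserving_snd (μ := volume.restrict U)
      (ν := (volume B)⁻¹ • volume.restrict B) |>.ae hae'
    filter_upwards [h1, h2] with w hw1 hw2 using hw1.sub hw2
  · have h1 := Measure.quasiMeasurePreserving_fst (μ := volume.restrict U)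
      (ν := (volume B)⁻¹ • volume.restrict B) |>.ae (ae_restrict_mem hUm)
    have h2 := Measure.quasiMeasurePreserving_snd (μ := volume.restrict U)
      (ν := (volume B)⁻¹ • volume.restrict B) |>.ae (hac.ae_le (ae_restrict_mem hB))
    filter_upwards [h1, h2] with w hw1 hw2
    obtain ⟨x, z⟩ := w
    -- The segment is compact in the open set `U`, so a whole neighbourhood of it lies in `U`. Once
    -- the bump radius is below the width `δ`, derivatives of the mollified `f` on the segment are
    -- mollified weak derivatives. The threshold depends on `(x, z)`.
    have hseg : IsCompact ((fun t : ℝ => segmentPoint ((x, z), t)) '' Set.Icc 0 1) :=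
      isCompact_Icc.image (continuous_segmentPoint.comp (by fun_prop))
    have hsegU : (fun t : ℝ => segmentPoint ((x, z), t)) '' Set.Icc 0 1 ⊆ U := by
      rintro _ ⟨t, ht, rfl⟩
      exact (hstar z hw2).add_smul_sub_mem hw1 ht.1 ht.2
    obtain ⟨δ, hδ, hδU⟩ := hseg.exists_cthickening_subset_open hU hsegU
    filter_upwards [(tendsto_shrinkingBump_rOut (d := d)).eventually_le_const hδ] with n hn
    refine (enorm_sub_le_lintegral_segment (mollify_contDiff hUm _ hf) x z).trans ?_
    refine setLIntegral_mono' measurableSet_Ioc fun t ht => ?_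
    simp only [hP]
    gcongr with i _
    · exact hdist x hw1 z (hBU hw2)
    · have hmem : segmentPoint ((x, z), t) ∈ (fun t : ℝ => segmentPoint ((x, z), t)) '' Set.Icc 0 1 :=
        ⟨t, Set.Ioc_subset_Icc_self ht, rfl⟩
      have hball : Metric.closedBall (segmentPoint ((x, z), t)) (shrinkingBump d n).rOut ⊆ U :=
        (Metric.closedBall_subset_closedBall hn).trans
          ((Metric.closedBall_subset_cthickening hmem δ).trans hδU)
      rw [partialDeriv_mollify hU (hfG i) hf hball]
  · intro n
    have hA := eLpNorm_segment_average_le hB0 hBfin hUfin hp (hPm n)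
    rw [finrank_euclideanSpace_fin] at hA
    refine hA.trans ?_
    gcongr
    simp only [hP]
    have hb : eLpNorm (fun y => ENNReal.ofReal h *
        ∑ i, ‖mollify U (shrinkingBump d n) (G i) y‖ₑ) p volume ≤
        ENNReal.ofReal h * eLpNorm (∑ i, fun y => ‖mollify U (shrinkingBump d n) (G i) y‖ₑ) p
          volume :=
      eLpNorm_le_nnreal_smul_eLpNorm_of_ae_le_mul' (c := h.toNNReal)
        (Filter.Eventually.of_forall fun y => by simp [ENNReal.ofReal]) p
    refine hb.trans ?_
    gcongr
    refine (eLpNorm_sum_le (fun i _ => (hGcont n i).measurable.enorm.aestronglyMeasurable)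
      hp).trans ?_
    gcongr with i _
    rw [eLpNorm_enorm]
    exact eLpNorm_mollify_le hUm _ (hG i) hp

/-- The Poincaré inequality on a set that is star-shaped with respect to every point of `B`. -/
theorem exists_eLpNorm_sub_const_le (hU : IsOpen U) (hUfin : volume U ≠ ⊤)
    {B : Set (EuclideanSpace ℝ (Fin d))} (hB : MeasurableSet B) (hBU : B ⊆ U)
    (hB0 : volume B ≠ 0) (hstar : ∀ z ∈ B, StarConvex ℝ z U) {h : ℝ}
    (hdist : ∀ x ∈ U, ∀ z ∈ U, dist x z ≤ h) (hf : IntegrableOn f U)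
    (hG : ∀ i, IntegrableOn (G i) U) (hfG : ∀ i, HasWeakDeriv U (Pi.single i 1) f (G i))
    {p : ℝ≥0∞} (hp : 1 ≤ p) :
    ∃ c : ℝ, eLpNorm (fun x => f x - c) p (volume.restrict U) ≤
      2 ^ d * (1 + volume U / volume B) *
        (ENNReal.ofReal h * ∑ i, eLpNorm (G i) p (volume.restrict U)) := by
  have hBfin : volume B ≠ ⊤ := ((measure_mono hBU).trans_lt hUfin.lt_top).ne
  have i1 : IsFiniteMeasure (volume.restrict U) := ⟨by simpa using hUfin.lt_top⟩
  have i2 : IsFiniteMeasure (volume.restrict B) := ⟨by simpa using hBfin.lt_top⟩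
  set ν : Measure (EuclideanSpace ℝ (Fin d)) := (volume B)⁻¹ • volume.restrict B with hν
  have i3 : IsProbabilityMeasure ν := ⟨by simp [hν, ENNReal.inv_mul_cancel hB0 hBfin]⟩
  have hfν : Integrable f ν :=
    Integrable.smul_measure (hf.mono_set hBU) (ENNReal.inv_ne_top.mpr hB0)
  -- The constant is the mean of `f` over `B`: then `f x - c` is the mean over `z` of `f x - f z`,
  -- and Jensen's inequality applies.
  refine ⟨∫ z, f z ∂ν, le_trans ?_
    (eLpNorm_sub_prod_le hU hUfin hB hBU hB0 hstar hdist hf hG hfG hp)⟩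
  have hm : AEStronglyMeasurable (fun w : EuclideanSpace ℝ (Fin d) × EuclideanSpace ℝ (Fin d) =>
      f w.1 - f w.2) ((volume.restrict U).prod ν) :=
    hf.aestronglyMeasurable.comp_fst.sub hfν.aestronglyMeasurable.comp_snd
  have hJ := eLpNorm_lintegral_le hp hm.enorm
  rw [eLpNorm_enorm] at hJ
  refine le_trans (eLpNorm_mono_enorm fun x => ?_) hJ
  have : f x - ∫ z, f z ∂ν = ∫ z, (f x - f z) ∂ν := by
    rw [integral_sub (integrable_const _) hfν]; simp
  rw [this]
  exact enorm_integral_le_lintegral_enorm _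

/-- The Poincaré inequality for functions of zero mean. -/
theorem eLpNorm_le_of_integral_eq_zero (hU : IsOpen U) (hUfin : volume U ≠ ⊤)
    {B : Set (EuclideanSpace ℝ (Fin d))} (hB : MeasurableSet B) (hBU : B ⊆ U)
    (hB0 : volume B ≠ 0) (hstar : ∀ z ∈ B, StarConvex ℝ z U) {h : ℝ}
    (hdist : ∀ x ∈ U, ∀ z ∈ U, dist x z ≤ h) (hf : IntegrableOn f U)
    (hG : ∀ i, IntegrableOn (G i) U) (hfG : ∀ i, HasWeakDeriv U (Pi.single i 1) f (G i))
    {p : ℝ≥0∞} (hp : 1 ≤ p) (hmean : ∫ x in U, f x = 0) :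
    eLpNorm f p (volume.restrict U) ≤ 2 * (2 ^ d * (1 + volume U / volume B) *
        (ENNReal.ofReal h * ∑ i, eLpNorm (G i) p (volume.restrict U))) := by
  obtain ⟨c, hc⟩ := exists_eLpNorm_sub_const_le hU hUfin hB hBU hB0 hstar hdist hf hG hfG hp
  have i1 : IsFiniteMeasure (volume.restrict U) := ⟨by simpa using hUfin.lt_top⟩
  have hp0 : p ≠ 0 := (zero_lt_one.trans_le hp).ne'
  have hU0 : volume U ≠ 0 := fun h0 => hB0 (measure_mono_null hBU h0)
  have hfc : AEStronglyMeasurable (fun x => f x - c) (volume.restrict U) :=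
    hf.aestronglyMeasurable.sub aestronglyMeasurable_const
  -- Since `f` has zero mean, `-c` is the mean of `f - c` over `U`, so Hölder's inequality bounds
  -- the norm of the constant by that of `f - c`. This is the source of the factor `2`.
  have hcle : eLpNorm (fun _ : EuclideanSpace ℝ (Fin d) => c) p (volume.restrict U) ≤
      eLpNorm (fun x => f x - c) p (volume.restrict U) := by
    have hne : volume.restrict U ≠ 0 := by simpa [Measure.restrict_eq_zero] using hU0
    rw [eLpNorm_const _ hp0 hne, Measure.restrict_apply_univ]
    have h1 : ‖c‖ₑ * volume U ≤ eLpNorm (fun x => f x - c) 1 (volume.restrict U) := by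
      have : ‖∫ x in U, (f x - c)‖ₑ = ‖c‖ₑ * volume U := by
        rw [integral_sub hf (integrable_const _), hmean]
        simp [enorm_mul, mul_comm, Measure.real, Real.enorm_eq_ofReal, hUfin]
      rw [← this, eLpNorm_one_eq_lintegral_enorm]
      exact enorm_integral_le_lintegral_enorm _
    have h2 := h1.trans (eLpNorm_le_eLpNorm_mul_rpow_measure_univ hp hfc)
    rw [Measure.restrict_apply_univ, ENNReal.toReal_one, one_div_one] at h2
    have hr0 : volume U ^ (1 - 1 / p.toReal) ≠ 0 := by
      simp [ENNReal.rpow_eq_zero_iff, hU0, hUfin]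
    have hr : volume U ^ (1 - 1 / p.toReal) ≠ ⊤ := by
      simp [ENNReal.rpow_eq_top_iff, hU0, hUfin]
    have hsplit : volume U = volume U ^ (1 / p.toReal) * volume U ^ (1 - 1 / p.toReal) := by
      rw [← ENNReal.rpow_add _ _ hU0 hUfin, add_sub_cancel, ENNReal.rpow_one]
    rw [hsplit, ← mul_assoc, ← hsplit] at h2
    exact (ENNReal.mul_le_mul_iff_left hr0 hr).mp h2
  calc eLpNorm f p (volume.restrict U)
      = eLpNorm ((fun x => f x - c) + fun _ => c) p (volume.restrict U) := by
        congr 1; ext x; simp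
    _ ≤ _ := eLpNorm_add_le hfc aestronglyMeasurable_const hp
    _ ≤ _ := add_le_add_right hcle _
    _ ≤ _ := by rw [← two_mul]; gcongr

end Mollification

/-! ### Bilinear forms on polynomials and well-posedness of the projector -/

section PolynomialForms

variable {U : Set (EuclideanSpace ℝ (Fin d))}

/-- An open set contains a product of intervals, and a polynomial that vanishes on a product of
infinite sets is zero. -/
theorem eq_zero_of_polyFun_eqOn_zero (hU : IsOpen U) (hne : U.Nonempty)
    {q : MvPolynomial (Fin d) ℝ} (hq : ∀ x ∈ U, polyFun q x = 0) : q = 0 := by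
  obtain ⟨x, hx⟩ := hne
  have hW : IsOpen ((fun y : Fin d → ℝ => (WithLp.toLp 2 y : EuclideanSpace ℝ (Fin d))) ⁻¹' U) :=
    hU.preimage (PiLp.continuous_toLp 2 _)
  obtain ⟨ε, hε, hball⟩ := Metric.isOpen_iff.mp hW x.ofLp hx
  rw [ball_pi _ hε] at hball
  refine MvPolynomial.funext_set (fun i => Metric.ball (x.ofLp i) ε)
    (fun i => infinite_of_mem_nhds (x.ofLp i) (Metric.ball_mem_nhds _ hε)) fun y hy => ?_
  rw [map_zero]
  exact hq _ (hball hy)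

theorem eq_C_of_pderiv_eq_zero {q : MvPolynomial (Fin d) ℝ}
    (hq : ∀ i, MvPolynomial.pderiv i q = 0) : q = MvPolynomial.C (MvPolynomial.coeff 0 q) := by
  ext m
  rw [MvPolynomial.coeff_C]
  split_ifs with h
  · rw [h]
  · obtain ⟨i, hi⟩ : ∃ i, m i ≠ 0 := by
      by_contra! hm
      exact h (Finsupp.ext fun i => (hm i).symm)
    have hm : m - Finsupp.single i 1 + Finsupp.single i 1 = m := by
      ext j
      rcases eq_or_ne j i with rfl | hj
      · simp; omega
      · simp [hj]
    have hc := MvPolynomial.coeff_pderiv (i := i) q (m - Finsupp.single i 1)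
    rw [hq, hm, MvPolynomial.coeff_zero] at hc
    rcases mul_eq_zero.mp hc.symm with h0 | h0
    · exact h0
    · exact absurd h0 (by positivity)

theorem exists_abs_polyFun_le (hU : Bornology.IsBounded U) (q : MvPolynomial (Fin d) ℝ) :
    ∃ c, ∀ x ∈ U, ‖polyFun q x‖ ≤ c := by
  obtain ⟨c, hc⟩ := hU.isCompact_closure.exists_bound_of_continuousOn
    (polyFun_continuous q).continuousOn
  exact ⟨c, fun x hx => hc x (subset_closure hx)⟩

theorem memLp_polyFun (hUm : MeasurableSet U) (hU : Bornology.IsBounded U)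
    (q : MvPolynomial (Fin d) ℝ) (p : ℝ≥0∞) : MemLp (polyFun q) p (volume.restrict U) := by
  obtain ⟨c, hc⟩ := exists_abs_polyFun_le hU q
  have : IsFiniteMeasure (volume.restrict U) := ⟨by simpa using hU.measure_lt_top⟩
  exact MemLp.of_bound (polyFun_continuous q).aestronglyMeasurable c
    ((ae_restrict_iff' hUm).mpr (Filter.Eventually.of_forall hc))

theorem integrableOn_polyFun (hUm : MeasurableSet U) (hU : Bornology.IsBounded U)
    (q : MvPolynomial (Fin d) ℝ) : IntegrableOn (polyFun q) U :=
  memLp_one_iff_integrable.mp (memLp_polyFun hUm hU q 1)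

theorem integrableOn_mul_polyFun (hUm : MeasurableSet U) (hU : Bornology.IsBounded U)
    {f : EuclideanSpace ℝ (Fin d) → ℝ} (hf : IntegrableOn f U) (q : MvPolynomial (Fin d) ℝ) :
    IntegrableOn (fun x => f x * polyFun q x) U := by
  obtain ⟨c, hc⟩ := exists_abs_polyFun_le hU q
  exact Integrable.mul_bdd hf (polyFun_continuous q).aestronglyMeasurable
    ((ae_restrict_iff' hUm).mpr (Filter.Eventually.of_forall hc))

/-- Integration against a fixed integrable function, as a linear form on polynomials. -/
def integralAgainst (hUm : MeasurableSet U) (hU : Bornology.IsBounded U)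
    {f : EuclideanSpace ℝ (Fin d) → ℝ} (hf : IntegrableOn f U) : MvPolynomial (Fin d) ℝ →ₗ[ℝ] ℝ where
  toFun q := ∫ x in U, f x * polyFun q x
  map_add' q r := by
    simp only [polyFun_add, Pi.add_apply, mul_add]
    exact integral_add (integrableOn_mul_polyFun hUm hU hf q) (integrableOn_mul_polyFun hUm hU hf r)
  map_smul' c q := by
    simp only [polyFun_smul, Pi.smul_apply, smul_eq_mul, RingHom.id_apply, mul_left_comm _ c]
    exact integral_const_mul _ _

/-- The `L²(U)` inner product of polynomials. -/
def integralForm (hUm : MeasurableSet U) (hU : Bornology.IsBounded U) :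
    MvPolynomial (Fin d) ℝ →ₗ[ℝ] MvPolynomial (Fin d) ℝ →ₗ[ℝ] ℝ where
  toFun q := integralAgainst hUm hU (integrableOn_polyFun hUm hU q)
  map_add' q r := LinearMap.ext fun w => by
    simp only [integralAgainst, LinearMap.coe_mk, AddHom.coe_mk, polyFun_add,
      Pi.add_apply, add_mul]
    exact integral_add (integrableOn_mul_polyFun hUm hU (integrableOn_polyFun hUm hU q) w)
      (integrableOn_mul_polyFun hUm hU (integrableOn_polyFun hUm hU r) w)
  map_smul' c q := LinearMap.ext fun w => by
    simp only [integralAgainst, LinearMap.coe_mk, AddHom.coe_mk, polyFun_smul,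
      Pi.smul_apply, smul_eq_mul, RingHom.id_apply, mul_assoc]
    exact integral_const_mul _ _

theorem integralForm_apply (hUm : MeasurableSet U) (hU : Bornology.IsBounded U)
    (q r : MvPolynomial (Fin d) ℝ) :
    integralForm hUm hU q r = ∫ x in U, polyFun q x * polyFun r x := rfl

theorem integralForm_self_nonneg (hUm : MeasurableSet U) (hU : Bornology.IsBounded U)
    (q : MvPolynomial (Fin d) ℝ) : 0 ≤ integralForm hUm hU q q :=
  integral_nonneg fun _ => mul_self_nonneg _

theorem integralForm_comm (hUm : MeasurableSet U) (hU : Bornology.IsBounded U)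
    (q r : MvPolynomial (Fin d) ℝ) : integralForm hUm hU q r = integralForm hUm hU r q := by
  simp only [integralForm_apply, mul_comm]

theorem eq_zero_of_integralForm_self (hUo : IsOpen U) (hne : U.Nonempty)
    (hU : Bornology.IsBounded U) {q : MvPolynomial (Fin d) ℝ}
    (hq : integralForm hUo.measurableSet hU q q = 0) : q = 0 := by
  rw [integralForm_apply, setIntegral_eq_zero_iff_of_nonneg_ae
    (Filter.Eventually.of_forall fun x => mul_self_nonneg _)
    (integrableOn_mul_polyFun hUo.measurableSet hU
      (integrableOn_polyFun hUo.measurableSet hU q) q)] at hq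
  have h := Measure.eqOn_open_of_ae_eq hq hUo (by fun_prop) continuousOn_const
  exact eq_zero_of_polyFun_eqOn_zero hUo hne fun x hx => mul_self_eq_zero.mp (h hx)

open Module in
-- Definiteness makes `b` injective as a map into the dual space, hence surjective by equality of
-- dimensions.
theorem exists_forall_form_eq {V : Type*} [AddCommGroup V] [Module ℝ V] [FiniteDimensional ℝ V]
    (b : V →ₗ[ℝ] V →ₗ[ℝ] ℝ) (hb : ∀ v, b v v = 0 → v = 0) (L : V →ₗ[ℝ] ℝ) :
    ∃ v, ∀ w, b v w = L w := by
  have hinj : Function.Injective b := by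
    rw [← LinearMap.ker_eq_bot, LinearMap.ker_eq_bot']
    exact fun v hv => hb v (by simp [hv])
  obtain ⟨v, hv⟩ := (LinearMap.injective_iff_surjective_of_finrank_eq_finrank
    (Subspace.dual_finrank_eq (K := ℝ) (V := V)).symm).mp hinj L
  exact ⟨v, fun w => by rw [hv]⟩

/-- The form `∫ ∇q · ∇r + (∫ q) (∫ r)`. -/
def ellipticForm (hUm : MeasurableSet U) (hU : Bornology.IsBounded U) :
    MvPolynomial (Fin d) ℝ →ₗ[ℝ] MvPolynomial (Fin d) ℝ →ₗ[ℝ] ℝ :=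
  ∑ i, (integralForm hUm hU).compl₁₂ (MvPolynomial.pderiv i).toLinearMap
      (MvPolynomial.pderiv i).toLinearMap +
    (integralForm hUm hU 1).smulRight (integralForm hUm hU 1)

theorem integral_sum_mul_polyFun (hUm : MeasurableSet U) (hU : Bornology.IsBounded U)
    {F : Fin d → EuclideanSpace ℝ (Fin d) → ℝ} (hF : ∀ i, IntegrableOn (F i) U)
    (w : Fin d → MvPolynomial (Fin d) ℝ) :
    ∫ x in U, ∑ i, F i x * polyFun (w i) x = ∑ i, integralAgainst hUm hU (hF i) (w i) :=
  integral_finsetSum _ fun i _ => integrableOn_mul_polyFun hUm hU (hF i) (w i)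

theorem ellipticForm_apply (hUm : MeasurableSet U) (hU : Bornology.IsBounded U)
    (q r : MvPolynomial (Fin d) ℝ) :
    ellipticForm hUm hU q r =
      (∫ x in U, ∑ i, polyFun (MvPolynomial.pderiv i q) x * polyFun (MvPolynomial.pderiv i r) x) +
        (∫ x in U, polyFun q x) * ∫ x in U, polyFun r x := by
  rw [integral_sum_mul_polyFun hUm hU fun i => integrableOn_polyFun hUm hU _]
  simp [ellipticForm, LinearMap.sum_apply, integralForm_apply, polyFun]
  rfl

/-- Both terms are nonnegative, so both vanish: the gradient term makes `q` constant, and the mean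
term makes this constant zero. -/
theorem eq_zero_of_ellipticForm_self (hUo : IsOpen U) (hne : U.Nonempty)
    (hU : Bornology.IsBounded U) {q : MvPolynomial (Fin d) ℝ}
    (hq : ellipticForm hUo.measurableSet hU q q = 0) : q = 0 := by
  have hUm := hUo.measurableSet
  rw [ellipticForm_apply, integral_sum_mul_polyFun hUm hU fun i => integrableOn_polyFun hUm hU _]
    at hq
  have hnn : ∀ i, 0 ≤ integralForm hUm hU (MvPolynomial.pderiv i q) (MvPolynomial.pderiv i q) :=
    fun i => integralForm_self_nonneg hUm hU _
  have hsum : ∑ i, integralForm hUm hU (MvPolynomial.pderiv i q) (MvPolynomial.pderiv i q) +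
    (∫ x in U, polyFun q x) * ∫ x in U, polyFun q x = 0 := hq
  have h1 := Finset.sum_nonneg fun i (_ : i ∈ Finset.univ) => hnn i
  have h2 := mul_self_nonneg (∫ x in U, polyFun q x)
  have h3 : ∑ i, integralForm hUm hU (MvPolynomial.pderiv i q) (MvPolynomial.pderiv i q) = 0 := by
    linarith
  have h4 : ∫ x in U, polyFun q x = 0 := mul_self_eq_zero.mp (by linarith)
  have h5 : ∀ i, MvPolynomial.pderiv i q = 0 := fun i =>
    eq_zero_of_integralForm_self hUo hne hU
      ((Finset.sum_eq_zero_iff_of_nonneg fun i _ => hnn i).mp h3 i (Finset.mem_univ i))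
  have h6 := eq_C_of_pderiv_eq_zero h5
  rw [h6] at h4 ⊢
  have hU0 : volume U ≠ 0 := (hUo.measure_pos volume hne).ne'
  simp only [polyFun_C, integral_const, smul_eq_mul, mul_eq_zero] at h4
  rcases h4 with h4 | h4
  · simp [Measure.real, ENNReal.toReal_eq_zero_iff, hU0, hU.measure_lt_top.ne] at h4
  · rw [h4, map_zero]

/-- The gradient equation and the mean condition merge into a single equation for the definite
`ellipticForm`. Testing it with `w = 1` recovers the mean condition; subtracting that recovers the
gradient equation. -/
theorem existsUnique_isEllipticProjection (hUo : IsOpen U) (hne : U.Nonempty)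
    (hU : Bornology.IsBounded U) (l : ℕ) {v : EuclideanSpace ℝ (Fin d) → ℝ}
    (hv : IntegrableOn v U) (hv' : ∀ i, IntegrableOn (weakDeriv U (Pi.single i 1) v) U) :
    ∃! q : MvPolynomial (Fin d) ℝ, IsEllipticProjection U l v q := by
  have hUm := hUo.measurableSet
  have hU0 : volume U ≠ 0 := (hUo.measure_pos volume hne).ne'
  have hUr : (volume U).toReal ≠ 0 := by
    simp [ENNReal.toReal_eq_zero_iff, hU0, hU.measure_lt_top.ne]
  let V := MvPolynomial.restrictTotalDegree (Fin d) ℝ l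
  have hVmem : ∀ q, q ∈ V ↔ q.totalDegree ≤ l := MvPolynomial.mem_restrictTotalDegree _ _
  refine existsUnique_of_exists_of_unique ?_ ?_
  · let L : MvPolynomial (Fin d) ℝ →ₗ[ℝ] ℝ :=
      ∑ i, integralAgainst hUm hU (hv' i) ∘ₗ (MvPolynomial.pderiv i).toLinearMap +
        (∫ x in U, v x) • integralForm hUm hU 1
    have hL : ∀ w, L w = (∫ x in U, ∑ i, weakDeriv U (Pi.single i 1) v x *
        polyFun (MvPolynomial.pderiv i w) x) + (∫ x in U, v x) * ∫ x in U, polyFun w x := by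
      intro w
      rw [integral_sum_mul_polyFun hUm hU hv']
      simp [L, integralForm_apply, polyFun]
    obtain ⟨⟨q, hqV⟩, hq⟩ := exists_forall_form_eq
      ((ellipticForm hUm hU).domRestrict₁₂ V V)
      (fun v hv => Subtype.ext (eq_zero_of_ellipticForm_self hUo hne hU hv)) (L.domRestrict V)
    have hq' : ∀ w : MvPolynomial (Fin d) ℝ, w.totalDegree ≤ l →
        ellipticForm hUm hU q w = L w := fun w hw => hq ⟨w, (hVmem w).mpr hw⟩
    have hmean : ∫ x in U, polyFun q x = ∫ x in U, v x := by
      have h := hq' 1 (by simp)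
      rw [hL, ellipticForm_apply] at h
      simpa [polyFun, Measure.real, hUr] using h
    refine ⟨q, (hVmem q).mp hqV, fun w hw => ?_, ?_⟩
    · have h := hq' w hw
      rw [hL, ellipticForm_apply, hmean] at h
      exact add_right_cancel h
    · rw [integral_sub (integrableOn_polyFun hUm hU q) hv, hmean, sub_self]
  · intro q r hq hr
    rw [← sub_eq_zero]
    refine eq_zero_of_ellipticForm_self hUo hne hU ?_
    have hdeg : (q - r).totalDegree ≤ l := (hVmem _).mp
      (V.sub_mem ((hVmem q).mpr hq.totalDegree_le) ((hVmem r).mpr hr.totalDegree_le))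
    have h1 := (hq.integral_grad_eq _ hdeg).trans (hr.integral_grad_eq _ hdeg).symm
    have h2 : ∫ x in U, polyFun q x = ∫ x in U, polyFun r x := by
      have e1 := hq.integral_sub_eq_zero
      have e2 := hr.integral_sub_eq_zero
      rw [integral_sub (integrableOn_polyFun hUm hU _) hv] at e1 e2
      linarith
    have h3 : ellipticForm hUm hU q (q - r) = ellipticForm hUm hU r (q - r) := by
      rw [ellipticForm_apply, ellipticForm_apply, h1, h2]
    rw [LinearMap.map_sub₂, h3, sub_self]

end PolynomialForms

/-! ### Inverse estimates for polynomials -/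

section PolynomialEstimates

theorem polyDeriv_smul (α : Fin d → ℕ) (c : ℝ) (q : MvPolynomial (Fin d) ℝ) :
    polyDeriv α (c • q) = c • polyDeriv α q := by
  induction α using multiIndex_induction generalizing q with
  | h0 => simp
  | h1 α i ih => rw [polyDeriv_add_single, polyDeriv_add_single, Derivation.map_smul, ih]

/-- The derivative `∂^α` of polynomials as a linear map. -/
def polyDerivLinear (α : Fin d → ℕ) : MvPolynomial (Fin d) ℝ →ₗ[ℝ] MvPolynomial (Fin d) ℝ where
  toFun := polyDeriv α
  map_add' := polyDeriv_add α
  map_smul' := polyDeriv_smul α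

open Module in
-- Equivalence of norms in finite dimension. Each coordinate functional of a basis is represented by
-- some `u j` in the `L²` product of the small ball, so Cauchy–Schwarz bounds the coordinates of
-- `q`; the finitely many functions `D (e j)` are bounded on the unit ball.
theorem exists_sq_polyFun_le (D : MvPolynomial (Fin d) ℝ →ₗ[ℝ] MvPolynomial (Fin d) ℝ) (l : ℕ)
    {ϱ : ℝ} (hϱ : 0 < ϱ) :
    ∃ C, 0 ≤ C ∧ ∀ q : MvPolynomial (Fin d) ℝ, q.totalDegree ≤ l →
      ∀ y ∈ Metric.closedBall (0 : EuclideanSpace ℝ (Fin d)) 1,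
        polyFun (D q) y ^ 2 ≤ C * ∫ x in Metric.ball 0 ϱ, polyFun q x * polyFun q x := by
  have hBo : IsOpen (Metric.ball (0 : EuclideanSpace ℝ (Fin d)) ϱ) := Metric.isOpen_ball
  have hBb : Bornology.IsBounded (Metric.ball (0 : EuclideanSpace ℝ (Fin d)) ϱ) :=
    Metric.isBounded_ball
  have hBn : (Metric.ball (0 : EuclideanSpace ℝ (Fin d)) ϱ).Nonempty := Metric.nonempty_ball.mpr hϱ
  let V := MvPolynomial.restrictTotalDegree (Fin d) ℝ l
  let b := (integralForm hBo.measurableSet hBb).domRestrict₁₂ V V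
  have hbapp : ∀ v w : V, b v w = integralForm hBo.measurableSet hBb v w := fun _ _ => rfl
  have hb0 : ∀ v, 0 ≤ b v v := fun v => integralForm_self_nonneg hBo.measurableSet hBb v.1
  have hbs : b.IsSymm := ⟨fun v w => integralForm_comm hBo.measurableSet hBb v.1 w.1⟩
  let e := Module.finBasis ℝ V
  choose u hu using fun j => exists_forall_form_eq b
    (fun v hv => Subtype.ext (eq_zero_of_integralForm_self hBo hBn hBb hv)) (e.coord j)
  choose c hc using fun j => exists_abs_polyFun_le
    (Metric.isBounded_closedBall (x := (0 : EuclideanSpace ℝ (Fin d))) (r := 1)) (D (e j).1)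
  refine ⟨(∑ j, b (u j) (u j)) * ∑ j, c j ^ 2,
    mul_nonneg (Finset.sum_nonneg fun j _ => hb0 _) (Finset.sum_nonneg fun j _ => sq_nonneg _),
    fun q hq y hy => ?_⟩
  let w : V := ⟨q, (MvPolynomial.mem_restrictTotalDegree _ _ _).mpr hq⟩
  have hrepr : q = ∑ j, e.repr w j • (e j).1 := by
    have h := congrArg V.subtype (e.sum_repr w)
    rw [map_sum] at h
    exact h.symm
  have hval : polyFun (D q) y = ∑ j, e.repr w j * polyFun (D (e j).1) y := by
    have hpf : ∀ f : Fin (finrank ℝ V) → MvPolynomial (Fin d) ℝ,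
        polyFun (∑ j, f j) y = ∑ j, polyFun (f j) y := fun f => by simp [polyFun]
    conv_lhs => rw [hrepr]
    rw [map_sum, hpf]
    simp
  have hcs : ∀ j, e.repr w j ^ 2 ≤ b (u j) (u j) * b w w := by
    intro j
    have h := LinearMap.BilinForm.apply_sq_le_of_symm b hb0 hbs (u j) w
    rwa [hu] at h
  rw [hval]
  calc _ ≤ (∑ j, e.repr w j ^ 2) * ∑ j, polyFun (D (e j).1) y ^ 2 :=
        Finset.sum_mul_sq_le_sq_mul_sq _ _ _
    _ ≤ (∑ j, b (u j) (u j) * b w w) * ∑ j, c j ^ 2 := by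
        refine mul_le_mul (Finset.sum_le_sum fun j _ => hcs j)
          (Finset.sum_le_sum fun j _ => ?_) (Finset.sum_nonneg fun j _ => sq_nonneg _)
          (Finset.sum_nonneg fun j _ => mul_nonneg (hb0 _) (hb0 _))
        exact sq_le_sq' (neg_le_of_abs_le (hc j y hy)) (le_of_abs_le (hc j y hy))
    _ = _ := by
        rw [← Finset.sum_mul, hbapp w w, integralForm_apply]
        ring

/-- The polynomial `y ↦ q (x₀ + h y)`. -/
def rescale (x₀ : EuclideanSpace ℝ (Fin d)) (h : ℝ) (q : MvPolynomial (Fin d) ℝ) :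
    MvPolynomial (Fin d) ℝ :=
  MvPolynomial.bind₁ (fun i => MvPolynomial.C (x₀ i) + MvPolynomial.C h * MvPolynomial.X i) q

theorem polyFun_rescale (x₀ : EuclideanSpace ℝ (Fin d)) (h : ℝ) (q : MvPolynomial (Fin d) ℝ)
    (y : EuclideanSpace ℝ (Fin d)) : polyFun (rescale x₀ h q) y = polyFun q (x₀ + h • y) := by
  induction q using MvPolynomial.induction_on with
  | C a => simp [polyFun, rescale]
  | add p q hp hq => simp_all [polyFun, rescale]
  | mul_X p i hp => simp_all [polyFun, rescale]

theorem totalDegree_rescale_le (x₀ : EuclideanSpace ℝ (Fin d)) (h : ℝ)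
    (q : MvPolynomial (Fin d) ℝ) : (rescale x₀ h q).totalDegree ≤ q.totalDegree := by
  have hlin : ∀ i : Fin d, (MvPolynomial.C (x₀ i) + MvPolynomial.C h * MvPolynomial.X i :
      MvPolynomial (Fin d) ℝ).totalDegree ≤ 1 := by
    intro i
    refine (MvPolynomial.totalDegree_add _ _).trans (max_le (by simp) ?_)
    refine (MvPolynomial.totalDegree_mul _ _).trans ?_
    simp
  unfold rescale
  conv_lhs => rw [q.as_sum]
  rw [map_sum]
  refine MvPolynomial.totalDegree_finsetSum_le fun s hs => ?_
  rw [MvPolynomial.bind₁_monomial]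
  refine (MvPolynomial.totalDegree_mul _ _).trans ?_
  rw [MvPolynomial.totalDegree_C, zero_add]
  refine (MvPolynomial.totalDegree_finsetProd _ _).trans ?_
  refine le_trans (Finset.sum_le_sum fun i _ => (MvPolynomial.totalDegree_pow _ _).trans
    (Nat.mul_le_mul_left _ (hlin i))) ?_
  simpa [Finsupp.sum] using MvPolynomial.le_totalDegree hs

theorem pderiv_rescale (x₀ : EuclideanSpace ℝ (Fin d)) (h : ℝ) (i : Fin d)
    (q : MvPolynomial (Fin d) ℝ) :
    MvPolynomial.pderiv i (rescale x₀ h q) = h • rescale x₀ h (MvPolynomial.pderiv i q) := by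
  apply MvPolynomial.funext
  intro y
  have e : polyFun (rescale x₀ h q) = fun y => polyFun q (x₀ + h • y) :=
    funext (polyFun_rescale x₀ h q)
  have h1 := congrFun (partialDeriv_polyFun i (rescale x₀ h q)) (WithLp.toLp 2 y)
  have h2 := congrFun (partialDeriv_polyFun i q) (x₀ + h • WithLp.toLp 2 y)
  change polyFun (MvPolynomial.pderiv i (rescale x₀ h q)) (WithLp.toLp 2 y) =
    polyFun (h • rescale x₀ h (MvPolynomial.pderiv i q)) (WithLp.toLp 2 y)
  have hd : HasFDerivAt (polyFun q) (fderiv ℝ (polyFun q) (x₀ + h • WithLp.toLp 2 y))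
      (x₀ + h • WithLp.toLp 2 y) :=
    (((polyFun_contDiff q).differentiable (by simp)) _).hasFDerivAt
  have hc := hd.comp (WithLp.toLp 2 y) (((hasFDerivAt_id _).const_smul h).const_add x₀)
  rw [← h1, polyFun_smul, Pi.smul_apply, polyFun_rescale, ← h2, e]
  have hc' : fderiv ℝ (fun y => polyFun q (x₀ + h • y)) (WithLp.toLp 2 y) = _ := hc.fderiv
  simp [partialDeriv, hc']

theorem polyDeriv_rescale (x₀ : EuclideanSpace ℝ (Fin d)) (h : ℝ) (α : Fin d → ℕ)
    (q : MvPolynomial (Fin d) ℝ) :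
    polyDeriv α (rescale x₀ h q) = h ^ (∑ i, α i) • rescale x₀ h (polyDeriv α q) := by
  induction α using multiIndex_induction generalizing q with
  | h0 => simp
  | h1 α i ih =>
    rw [polyDeriv_add_single, pderiv_rescale, polyDeriv_smul, ih, smul_smul, sum_add_single,
      polyDeriv_add_single, pow_succ']

theorem setIntegral_ball_rescale (x₀ : EuclideanSpace ℝ (Fin d)) {h : ℝ} (hh : 0 < h) (ϱ : ℝ)
    (f : EuclideanSpace ℝ (Fin d) → ℝ) :
    h ^ d * ∫ y in Metric.ball 0 ϱ, f (x₀ + h • y) = ∫ x in Metric.ball x₀ (h * ϱ), f x := by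
  rw [Measure.setIntegral_comp_smul_of_pos volume (fun y => f (x₀ + y)) _ hh,
    finrank_euclideanSpace_fin, smul_eq_mul, mul_inv_cancel_left₀ (by positivity),
    smul_ball hh.ne', smul_zero, Real.norm_of_nonneg hh.le]
  have hm := (measurePreserving_add_left volume x₀).setIntegral_preimage_emb
    (measurableEmbedding_addLeft x₀) f (Metric.ball x₀ (h * ϱ))
  rwa [show (fun y => x₀ + y) ⁻¹' Metric.ball x₀ (h * ϱ) = Metric.ball 0 (h * ϱ) by
    ext y; simp [Metric.mem_ball, dist_eq_norm]] at hm

/-- Pointwise estimate of the derivatives of a polynomial on a ball by its `L²` norm on a set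
containing a proportional ball. -/
theorem exists_sq_polyDeriv_le (d l : ℕ) (α : Fin d → ℕ) {ϱ : ℝ} (hϱ : 0 < ϱ) :
    ∃ C, 0 ≤ C ∧ ∀ (U : Set (EuclideanSpace ℝ (Fin d))) (x₀ : EuclideanSpace ℝ (Fin d)) (h : ℝ),
      0 < h → MeasurableSet U → Metric.ball x₀ (ϱ * h) ⊆ U → U ⊆ Metric.closedBall x₀ h →
      ∀ q : MvPolynomial (Fin d) ℝ, q.totalDegree ≤ l → ∀ x ∈ U,
        (h ^ (∑ i, α i) * polyFun (polyDeriv α q) x) ^ 2 * volume.real U ≤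
          C * ∫ x in U, polyFun q x * polyFun q x := by
  obtain ⟨C, hC0, hC⟩ := exists_sq_polyFun_le (polyDerivLinear (d := d) α) l hϱ
  set β := volume.real (Metric.ball (0 : EuclideanSpace ℝ (Fin d)) 1)
  refine ⟨C * β, mul_nonneg hC0 measureReal_nonneg, fun U x₀ h hh hUm hBU hUB q hq x hx => ?_⟩
  have hvol : volume.real U ≤ h ^ d * β := by
    refine (measureReal_mono hUB measure_closedBall_lt_top.ne).trans (le_of_eq ?_)
    rw [measureReal_def, Measure.addHaar_closedBall volume x₀ hh.le, ENNReal.toReal_mul,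
      finrank_euclideanSpace_fin, ENNReal.toReal_ofReal (by positivity)]
    rfl
  -- Rescaling by `h` about `x₀` places `U` between the balls of radii `ϱ` and `1`. Each derivative
  -- produces a factor `h`, and the Jacobian `h ^ d` compensates for `|U| ≤ h ^ d β`.
  set y : EuclideanSpace ℝ (Fin d) := h⁻¹ • (x - x₀) with hy
  have hxy : x₀ + h • y = x := by rw [hy, smul_inv_smul₀ hh.ne']; abel
  have hyB : y ∈ Metric.closedBall (0 : EuclideanSpace ℝ (Fin d)) 1 := by
    have := hUB hx
    rw [mem_closedBall_iff_norm] at this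
    rw [mem_closedBall_zero_iff, hy, norm_smul, norm_inv, Real.norm_of_nonneg hh.le,
      inv_mul_le_iff₀ hh, mul_one]
    exact this
  have h1 := hC (rescale x₀ h q) ((totalDegree_rescale_le x₀ h q).trans hq) y hyB
  have h2 : polyFun (polyDerivLinear α (rescale x₀ h q)) y =
      h ^ (∑ i, α i) * polyFun (polyDeriv α q) x := by
    change polyFun (polyDeriv α (rescale x₀ h q)) y = _
    rw [polyDeriv_rescale, polyFun_smul, Pi.smul_apply, polyFun_rescale, hxy, smul_eq_mul]
  simp only [h2, polyFun_rescale] at h1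
  have hUb : Bornology.IsBounded U := Metric.isBounded_closedBall.subset hUB
  calc _ ≤ (C * ∫ y in Metric.ball 0 ϱ, polyFun q (x₀ + h • y) * polyFun q (x₀ + h • y)) *
        (h ^ d * β) := by
        exact mul_le_mul h1 hvol measureReal_nonneg
          (mul_nonneg hC0 (integral_nonneg fun _ => mul_self_nonneg _))
    _ = C * β * ∫ x in Metric.ball x₀ (h * ϱ), polyFun q x * polyFun q x := by
        rw [← setIntegral_ball_rescale x₀ hh ϱ fun x => polyFun q x * polyFun q x]
        ring
    _ ≤ _ := by
        refine mul_le_mul_of_nonneg_left ?_ (mul_nonneg hC0 measureReal_nonneg)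
        rw [mul_comm h ϱ]
        exact setIntegral_mono_set
          (integrableOn_mul_polyFun hUm hUb (integrableOn_polyFun hUm hUb q) q)
          (Filter.Eventually.of_forall fun _ => mul_self_nonneg _) hBU.eventuallyLE

end PolynomialEstimates

/-- `U` is open, of diameter at most `h`, and star-shaped with respect to every point of the ball of
centre `x₀` and radius `ϱ h`. -/
structure IsStarShaped (U : Set (EuclideanSpace ℝ (Fin d))) (x₀ : EuclideanSpace ℝ (Fin d))
    (ϱ h : ℝ) : Prop where
  isOpen : IsOpen U
  pos : 0 < h
  ball_subset : Metric.ball x₀ (ϱ * h) ⊆ U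
  starConvex : ∀ y ∈ Metric.ball x₀ (ϱ * h), StarConvex ℝ y U
  dist_le : ∀ x ∈ U, ∀ y ∈ U, dist x y ≤ h

/-! ### Geometry of star-shaped sets -/

namespace IsStarShaped

variable {U : Set (EuclideanSpace ℝ (Fin d))} {x₀ : EuclideanSpace ℝ (Fin d)} {ϱ h : ℝ}

theorem mem (hS : IsStarShaped U x₀ ϱ h) (hϱ : 0 < ϱ) : x₀ ∈ U :=
  hS.ball_subset (Metric.mem_ball_self (mul_pos hϱ hS.pos))

theorem subset_closedBall (hS : IsStarShaped U x₀ ϱ h) (hϱ : 0 < ϱ) :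
    U ⊆ Metric.closedBall x₀ h := fun x hx => hS.dist_le x hx x₀ (hS.mem hϱ)

theorem isBounded (hS : IsStarShaped U x₀ ϱ h) (hϱ : 0 < ϱ) : Bornology.IsBounded U :=
  Metric.isBounded_closedBall.subset (hS.subset_closedBall hϱ)

theorem volume_ne_top (hS : IsStarShaped U x₀ ϱ h) (hϱ : 0 < ϱ) : volume U ≠ ⊤ :=
  (hS.isBounded hϱ).measure_lt_top.ne

theorem volume_ne_zero (hS : IsStarShaped U x₀ ϱ h) (hϱ : 0 < ϱ) : volume U ≠ 0 :=
  (hS.isOpen.measure_pos volume ⟨x₀, hS.mem hϱ⟩).ne'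

/-- `U` is contained in the closed ball of radius `h` about `x₀`, which makes the Poincaré constant
depend on `d` and `ϱ` only. -/
theorem volume_div_le (hS : IsStarShaped U x₀ ϱ h) (hϱ : 0 < ϱ) :
    volume U / volume (Metric.ball x₀ (ϱ * h)) ≤ ENNReal.ofReal (ϱ⁻¹ ^ d) := by
  refine ENNReal.div_le_of_le_mul ((measure_mono (hS.subset_closedBall hϱ)).trans ?_)
  rw [Measure.addHaar_closedBall volume x₀ hS.pos.le,
    Measure.addHaar_ball_of_pos volume x₀ (mul_pos hϱ hS.pos), finrank_euclideanSpace_fin, ← mul_assoc,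
    ← ENNReal.ofReal_mul (by positivity), ← mul_pow, inv_mul_cancel_left₀ hϱ.ne']

theorem eLpNorm_le (hS : IsStarShaped U x₀ ϱ h) (hϱ : 0 < ϱ)
    {f : EuclideanSpace ℝ (Fin d) → ℝ} {G : Fin d → EuclideanSpace ℝ (Fin d) → ℝ}
    (hf : IntegrableOn f U) (hG : ∀ i, IntegrableOn (G i) U)
    (hfG : ∀ i, HasWeakDeriv U (Pi.single i 1) f (G i)) {p : ℝ≥0∞} (hp : 1 ≤ p)
    (hmean : ∫ x in U, f x = 0) :
    eLpNorm f p (volume.restrict U) ≤ ENNReal.ofReal (2 * (2 ^ d * (1 + ϱ⁻¹ ^ d)) * h) *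
      ∑ i, eLpNorm (G i) p (volume.restrict U) := by
  refine (eLpNorm_le_of_integral_eq_zero hS.isOpen (hS.volume_ne_top hϱ) measurableSet_ball
    hS.ball_subset (Metric.measure_ball_pos volume x₀ (mul_pos hϱ hS.pos)).ne' hS.starConvex
    hS.dist_le hf hG hfG hp hmean).trans ?_
  rw [ENNReal.ofReal_mul (by positivity), ENNReal.ofReal_mul (by positivity),
    ENNReal.ofReal_mul (by positivity), ENNReal.ofReal_add (by positivity) (by positivity),
    ENNReal.ofReal_pow (by norm_num), ENNReal.ofReal_one, ENNReal.ofReal_ofNat]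
  have := hS.volume_div_le hϱ
  calc _ ≤ 2 * (2 ^ d * (1 + ENNReal.ofReal (ϱ⁻¹ ^ d)) * (ENNReal.ofReal h *
        ∑ i, eLpNorm (G i) p (volume.restrict U))) := by gcongr
    _ = _ := by ring

end IsStarShaped

/-! ### Sobolev functions and the iterated Poincaré inequality -/

section Sobolev

variable {U : Set (EuclideanSpace ℝ (Fin d))} {s : ℕ} {p : ℝ≥0∞}
  {v : EuclideanSpace ℝ (Fin d) → ℝ}

theorem MemSobolev.hasWeakDeriv (hv : MemSobolev U s p v) {α : Fin d → ℕ} (hα : ∑ i, α i ≤ s) :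
    HasWeakDeriv U α v (weakDeriv U α v) :=
  hasWeakDeriv_weakDeriv ((hv α hα).imp fun _ h => h.1)

theorem MemSobolev.memLp (hU : IsOpen U) (hv : MemSobolev U s p v) {α : Fin d → ℕ}
    (hα : ∑ i, α i ≤ s) : MemLp (weakDeriv U α v) p (volume.restrict U) := by
  obtain ⟨g, hg, hgp⟩ := hv α hα
  exact hgp.ae_eq (hg.weakDeriv_ae_eq hU).symm

theorem MemSobolev.mono {t : ℕ} (hv : MemSobolev U s p v) (hts : t ≤ s) : MemSobolev U t p v :=
  fun α hα => hv α (hα.trans hts)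

theorem MemSobolev.mono_exponent {p' : ℝ≥0∞} (hU : volume U ≠ ⊤) (hv : MemSobolev U s p v)
    (hp : p' ≤ p) : MemSobolev U s p' v := fun α hα => by
  have : IsFiniteMeasure (volume.restrict U) := ⟨by simpa using hU.lt_top⟩
  obtain ⟨g, hg, hgp⟩ := hv α hα
  exact ⟨g, hg, hgp.mono_exponent hp⟩

theorem MemSobolev.integrableOn_weakDeriv (hU : IsOpen U) (hfin : volume U ≠ ⊤) (hp : 1 ≤ p)
    (hv : MemSobolev U s p v) {α : Fin d → ℕ} (hα : ∑ i, α i ≤ s) :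
    IntegrableOn (weakDeriv U α v) U :=
  memLp_one_iff_integrable.mp ((hv.mono_exponent hfin hp).memLp hU hα)

theorem MemSobolev.weakDeriv_zero_ae_eq (hU : IsOpen U) (hv : MemSobolev U s p v) :
    weakDeriv U 0 v =ᵐ[volume.restrict U] v :=
  (hasWeakDeriv_zero (hv.hasWeakDeriv (α := 0) (by simp)).1).weakDeriv_ae_eq hU

theorem MemSobolev.integrableOn (hU : IsOpen U) (hfin : volume U ≠ ⊤) (hp : 1 ≤ p)
    (hv : MemSobolev U s p v) : IntegrableOn v U :=
  (hv.integrableOn_weakDeriv hU hfin hp (α := 0) (by simp)).congr (hv.weakDeriv_zero_ae_eq hU)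

theorem MemSobolev.sub_polyFun (hU : IsOpen U) (hb : Bornology.IsBounded U)
    (hv : MemSobolev U s p v) (q : MvPolynomial (Fin d) ℝ) : MemSobolev U s p (v - polyFun q) :=
  fun α hα => ⟨_, (hv.hasWeakDeriv hα).sub (hasWeakDeriv_polyFun U α q),
    (hv.memLp hU hα).sub (memLp_polyFun hU.measurableSet hb _ p)⟩

theorem MemSobolev.weakDeriv_sub_polyFun_ae_eq (hU : IsOpen U) (hv : MemSobolev U s p v)
    {α : Fin d → ℕ} (hα : ∑ i, α i ≤ s) (q : MvPolynomial (Fin d) ℝ) :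
    weakDeriv U α (v - polyFun q) =ᵐ[volume.restrict U]
      weakDeriv U α v - polyFun (polyDeriv α q) :=
  ((hv.hasWeakDeriv hα).sub (hasWeakDeriv_polyFun U α q)).weakDeriv_ae_eq hU

theorem mem_piAntidiag_univ {α : Fin d → ℕ} {m : ℕ} :
    α ∈ Finset.piAntidiag Finset.univ m ↔ ∑ i, α i = m := by
  simp [Finset.mem_piAntidiag]

theorem eLpNorm_weakDeriv_le_sobolevSeminorm {α : Fin d → ℕ} {m : ℕ} (hα : ∑ i, α i = m) :
    eLpNorm (weakDeriv U α v) p (volume.restrict U) ≤ sobolevSeminorm U m p v :=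
  Finset.single_le_sum (f := fun α => eLpNorm (weakDeriv U α v) p (volume.restrict U))
    (fun _ _ => zero_le) (mem_piAntidiag_univ.mpr hα)

theorem sobolevSeminorm_le_card_mul {m : ℕ} {c : ℝ≥0∞}
    (h : ∀ α : Fin d → ℕ, ∑ i, α i = m → eLpNorm (weakDeriv U α v) p (volume.restrict U) ≤ c) :
    sobolevSeminorm U m p v ≤
      (Finset.piAntidiag (Finset.univ : Finset (Fin d)) m).card * c := by
  unfold sobolevSeminorm
  rw [← nsmul_eq_mul]
  exact Finset.sum_le_card_nsmul _ _ _ fun α hα => h α (mem_piAntidiag_univ.mp hα)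

theorem sum_single (i : Fin d) : ∑ j, (Pi.single i 1 : Fin d → ℕ) j = 1 := by simp

theorem sum_eLpNorm_le_sobolevSeminorm {α : Fin d → ℕ} {m : ℕ} (hα : ∑ i, α i = m) :
    ∑ i, eLpNorm (weakDeriv U (α + Pi.single i 1) v) p (volume.restrict U) ≤
      d * sobolevSeminorm U (m + 1) p v := by
  refine (Finset.sum_le_card_nsmul _ _ (sobolevSeminorm U (m + 1) p v) fun i _ =>
    eLpNorm_weakDeriv_le_sobolevSeminorm (by rw [sum_add_single, hα])).trans (le_of_eq ?_)
  simp

/-- Iterated Poincaré inequality for functions whose derivatives have zero mean. -/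
theorem exists_sobolevSeminorm_le (d : ℕ) {ϱ : ℝ} (hϱ : 0 < ϱ) (k m : ℕ) :
    ∃ A : ℝ, 0 ≤ A ∧ ∀ (U : Set (EuclideanSpace ℝ (Fin d))) (x₀ : EuclideanSpace ℝ (Fin d)) (h : ℝ),
      IsStarShaped U x₀ ϱ h → ∀ p : ℝ≥0∞, 1 ≤ p → ∀ v : EuclideanSpace ℝ (Fin d) → ℝ,
        MemSobolev U (m + k) p v →
        (∀ α : Fin d → ℕ, ∑ i, α i < m + k → ∫ x in U, weakDeriv U α v x = 0) →
        sobolevSeminorm U m p v ≤ ENNReal.ofReal (A * h ^ k) * sobolevSeminorm U (m + k) p v := by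
  -- One Poincaré inequality passes from order `m` to order `m + 1`; the remaining `k` steps start
  -- there, so `m` has to vary.
  induction k generalizing m with
  | zero => exact ⟨1, zero_le_one, fun U x₀ h hS p hp v hv hmean => by simp⟩
  | succ k ih =>
    obtain ⟨A, hA, ih⟩ := ih (m + 1)
    set K : ℝ := 2 * (2 ^ d * (1 + ϱ⁻¹ ^ d))
    set N : ℕ := (Finset.piAntidiag (Finset.univ : Finset (Fin d)) m).card
    -- `N` counts the multi-indices of order `m`, `K` is the Poincaré constant, `d` counts the first
    -- derivatives of each function, and `A` comes from the remaining steps.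
    refine ⟨N * (K * d) * A, by positivity, fun U x₀ h hS p hp v hv hmean => ?_⟩
    have hh := hS.pos
    have hfin := hS.volume_ne_top hϱ
    have e : m + 1 + k = m + (k + 1) := by ring
    have h2 := ih U x₀ h hS p hp v (e ▸ hv) (e ▸ hmean)
    rw [e] at h2
    have h1 : sobolevSeminorm U m p v ≤ N * (ENNReal.ofReal (K * h) *
        (d * sobolevSeminorm U (m + 1) p v)) := by
      refine sobolevSeminorm_le_card_mul fun α hα => ?_
      have hα' : ∀ i, ∑ j, (α + Pi.single i 1 : Fin d → ℕ) j ≤ m + (k + 1) := fun i => by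
        rw [sum_add_single]; omega
      have hαk : ∑ i, α i ≤ m + (k + 1) := by omega
      refine (hS.eLpNorm_le hϱ (hv.integrableOn_weakDeriv hS.isOpen hfin hp hαk)
        (fun i => hv.integrableOn_weakDeriv hS.isOpen hfin hp (hα' i))
        (fun i => (hv.hasWeakDeriv hαk).of_add_single (hv.hasWeakDeriv (hα' i))) hp
        (hmean α (by omega))).trans ?_
      gcongr
      exact sum_eLpNorm_le_sobolevSeminorm hα
    have hK : 0 ≤ K := by positivity
    clear_value K
    calc _ ≤ _ := h1
      _ ≤ N * (ENNReal.ofReal (K * h) * (d * (ENNReal.ofReal (A * h ^ k) *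
          sobolevSeminorm U (m + (k + 1)) p v))) := by gcongr
      _ = _ := by
        have : ENNReal.ofReal (N * (K * d) * A * h ^ (k + 1)) =
            N * ENNReal.ofReal (K * h) * d * ENNReal.ofReal (A * h ^ k) := by
          rw [show (N * (K * d) * A * h ^ (k + 1) : ℝ) = N * (K * h) * d * (A * h ^ k) by ring,
            ENNReal.ofReal_mul (by positivity), ENNReal.ofReal_mul (by positivity),
            ENNReal.ofReal_mul (p := (N : ℝ)) (by positivity), ENNReal.ofReal_natCast,
            ENNReal.ofReal_natCast]
        rw [this]
        ring

end Sobolev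

/-! ### Polynomials with prescribed means of derivatives -/

section MeanMatching

theorem polyDeriv_monomial_self (α : Fin d → ℕ) (a : ℝ) :
    polyDeriv α (MvPolynomial.monomial (Finsupp.equivFunOnFinite.symm α) a) =
      MvPolynomial.C (a * ∏ i, ((α i).factorial : ℝ)) := by
  rw [polyDeriv_monomial]
  simp [Nat.descFactorial_self]

/-- Distinct multi-indices of equal order satisfy `β i < α i` for some `i`, so differentiation in
that variable kills the monomial. -/
theorem polyDeriv_monomial_of_ne {α β : Fin d → ℕ} (hαβ : α ≠ β) (hsum : ∑ i, α i = ∑ i, β i)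
    (a : ℝ) : polyDeriv α (MvPolynomial.monomial (Finsupp.equivFunOnFinite.symm β) a) = 0 := by
  rw [polyDeriv_monomial]
  obtain ⟨i, hi⟩ : ∃ i, β i < α i := by
    by_contra! h
    exact hαβ (funext fun i =>
      (Finset.sum_eq_sum_iff_of_le fun i _ => h i).mp hsum i (Finset.mem_univ i))
  rw [Finset.prod_eq_zero (Finset.mem_univ i) (by simpa using Nat.descFactorial_of_lt hi)]
  simp

theorem polyDeriv_eq_zero_of_forall_C {Q : MvPolynomial (Fin d) ℝ} {k : ℕ}
    (hQ : ∀ α : Fin d → ℕ, ∑ i, α i = k → ∃ c, polyDeriv α Q = MvPolynomial.C c)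
    {α : Fin d → ℕ} (hα : ∑ i, α i = k + 1) : polyDeriv α Q = 0 := by
  induction α using multiIndex_induction with
  | h0 => simp at hα
  | h1 α i _ =>
    rw [sum_add_single] at hα
    obtain ⟨c, hc⟩ := hQ α (by omega)
    rw [polyDeriv_add_single, ← pderiv_polyDeriv, hc, MvPolynomial.pderiv_C]

/-- A polynomial whose derivatives of order less than `k` have prescribed integrals. -/
theorem exists_polynomial_integral_polyDeriv_eq {U : Set (EuclideanSpace ℝ (Fin d))}
    (hUm : MeasurableSet U) (hb : Bornology.IsBounded U) (hU0 : volume U ≠ 0) (k : ℕ)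
    (c : (Fin d → ℕ) → ℝ) :
    ∃ Q : MvPolynomial (Fin d) ℝ, Q.totalDegree ≤ k - 1 ∧
      (∀ α : Fin d → ℕ, ∑ i, α i = k → polyDeriv α Q = 0) ∧
      ∀ α : Fin d → ℕ, ∑ i, α i < k → ∫ x in U, polyFun (polyDeriv α Q) x = c α := by
  induction k generalizing c with
  | zero =>
    -- For `k = 0` the degree bound `k - 1` is truncated to `0`, and the zero polynomial serves.
    refine ⟨0, by simp, fun α _ => ?_, fun α hα => absurd hα (by simp)⟩
    simpa using polyDeriv_smul α 0 0
  | succ k ih =>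
    have hUr : volume.real U ≠ 0 := by
      simp [Measure.real, ENNReal.toReal_eq_zero_iff, hU0, hb.measure_lt_top.ne]
    -- `T` settles the integrals of order `k`: there its derivatives are the constants `c α / |U|`.
    -- The induction hypothesis then supplies a correction of the lower-order integrals whose
    -- derivatives of order `k` vanish, so it does not disturb this choice.
    let T : MvPolynomial (Fin d) ℝ := ∑ β ∈ Finset.piAntidiag Finset.univ k,
      MvPolynomial.monomial (Finsupp.equivFunOnFinite.symm β)
        (c β / (volume.real U * ∏ i, ((β i).factorial : ℝ)))
    have hTdeg : T.totalDegree ≤ k := by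
      refine MvPolynomial.totalDegree_finsetSum_le fun β hβ => ?_
      refine (MvPolynomial.totalDegree_monomial_le _ _).trans (le_of_eq ?_)
      rw [← mem_piAntidiag_univ.mp hβ, Finsupp.sum_fintype _ _ (fun _ => rfl)]
      rfl
    have hT : ∀ α : Fin d → ℕ, ∑ i, α i = k →
        polyDeriv α T = MvPolynomial.C (c α / volume.real U) := by
      intro α hα
      change polyDerivLinear α T = _
      rw [map_sum, Finset.sum_eq_single_of_mem α (mem_piAntidiag_univ.mpr hα)]
      · refine (polyDeriv_monomial_self α _).trans ?_
        have : ∏ i, ((α i).factorial : ℝ) ≠ 0 :=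
          Finset.prod_ne_zero_iff.mpr fun i _ => by positivity
        congr 1
        field_simp
      · intro β hβ hne
        exact polyDeriv_monomial_of_ne hne.symm (hα.trans (mem_piAntidiag_univ.mp hβ).symm) _
    obtain ⟨Q, hQdeg, hQ0, hQ⟩ := ih fun α => c α - ∫ x in U, polyFun (polyDeriv α T) x
    have hTQ : ∀ α : Fin d → ℕ, ∑ i, α i = k →
        polyDeriv α (T + Q) = MvPolynomial.C (c α / volume.real U) := fun α hα => by
      rw [polyDeriv_add, hT α hα, hQ0 α hα, add_zero]
    refine ⟨T + Q, (MvPolynomial.totalDegree_add _ _).trans (max_le hTdeg (by omega)),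
      fun α hα => polyDeriv_eq_zero_of_forall_C (fun α hα => ⟨_, hTQ α hα⟩) hα, fun α hα => ?_⟩
    rcases Nat.lt_succ_iff_lt_or_eq.mp hα with hlt | heq
    · rw [polyDeriv_add, polyFun_add]
      simp only [Pi.add_apply]
      rw [integral_add (integrableOn_polyFun hUm hb _) (integrableOn_polyFun hUm hb _), hQ α hlt]
      ring
    · rw [hTQ α heq]
      simp only [polyFun_C, integral_const, smul_eq_mul, measureReal_restrict_apply_univ]
      field_simp

end MeanMatching

/-! ### Stability of the elliptic projector -/

section Stability

variable {U : Set (EuclideanSpace ℝ (Fin d))}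

/-- The defining equations are linear, and a polynomial of degree at most `l` is its own projection.
-/
theorem IsEllipticProjection.sub_polyFun (hUo : IsOpen U) (hb : Bornology.IsBounded U) {l : ℕ}
    {v : EuclideanSpace ℝ (Fin d) → ℝ} {q Q : MvPolynomial (Fin d) ℝ}
    (hv : MemSobolev U 1 1 v) (hq : IsEllipticProjection U l v q) (hQ : Q.totalDegree ≤ l) :
    IsEllipticProjection U l (v - polyFun Q) (q - Q) := by
  have hUm := hUo.measurableSet
  have hfin := hb.measure_lt_top (μ := volume).ne
  have hae : ∀ᵐ x ∂volume.restrict U, ∀ i, weakDeriv U (Pi.single i 1) (v - polyFun Q) x =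
      weakDeriv U (Pi.single i 1) v x - polyFun (MvPolynomial.pderiv i Q) x := by
    rw [ae_all_iff]
    intro i
    have h := hv.weakDeriv_sub_polyFun_ae_eq hUo (sum_single i).le Q
    have e : polyDeriv (Pi.single i 1) Q = MvPolynomial.pderiv i Q := by
      have := polyDeriv_add_single 0 i Q
      rwa [zero_add, polyDeriv_zero] at this
    rw [e] at h
    exact h
  refine ⟨(MvPolynomial.totalDegree_sub _ _).trans (max_le hq.totalDegree_le hQ),
    fun w hw => ?_, ?_⟩
  · have hi1 : ∀ f : Fin d → EuclideanSpace ℝ (Fin d) → ℝ, (∀ i, IntegrableOn (f i) U) →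
        IntegrableOn (fun x => ∑ i, f i x * polyFun (MvPolynomial.pderiv i w) x) U := fun f hf =>
      integrable_finsetSum _ fun i _ => integrableOn_mul_polyFun hUm hb (hf i) _
    have h1 := hq.integral_grad_eq w hw
    have h2 : ∫ x in U, ∑ i, weakDeriv U (Pi.single i 1) (v - polyFun Q) x *
        polyFun (MvPolynomial.pderiv i w) x =
        ∫ x in U, (∑ i, weakDeriv U (Pi.single i 1) v x * polyFun (MvPolynomial.pderiv i w) x -
          ∑ i, polyFun (MvPolynomial.pderiv i Q) x * polyFun (MvPolynomial.pderiv i w) x) := by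
      refine integral_congr_ae ?_
      filter_upwards [hae] with x hx
      simp only [hx, sub_mul, Finset.sum_sub_distrib]
    rw [h2, integral_sub (hi1 _ fun i => hv.integrableOn_weakDeriv hUo hfin le_rfl (sum_single i).le)
      (hi1 _ fun i => integrableOn_polyFun hUm hb _), ← h1,
      ← integral_sub (hi1 _ fun i => integrableOn_polyFun hUm hb _)
      (hi1 _ fun i => integrableOn_polyFun hUm hb _)]
    refine integral_congr_ae (Filter.Eventually.of_forall fun x => ?_)
    simp [sub_mul, Finset.sum_sub_distrib]
  · have h := hq.integral_sub_eq_zero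
    simpa using h

theorem totalDegree_pderiv_le (i : Fin d) (q : MvPolynomial (Fin d) ℝ) :
    (MvPolynomial.pderiv i q).totalDegree ≤ q.totalDegree := by
  refine Finset.sup_le fun m hm => ?_
  have hm' : m + Finsupp.single i 1 ∈ q.support := by
    rw [MvPolynomial.mem_support_iff, MvPolynomial.coeff_pderiv] at hm
    exact MvPolynomial.mem_support_iff.mpr (left_ne_zero_of_mul hm)
  refine le_trans ?_ (MvPolynomial.le_totalDegree hm')
  rw [Finsupp.sum_add_index' (fun _ => rfl) (fun _ _ _ => rfl)]
  exact Nat.le_add_right _ _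

/-- Stability of the elliptic projector: pointwise bound of the derivatives of the projection. -/
theorem exists_abs_polyDeriv_ellipticProjection_le (d l : ℕ) {ϱ : ℝ} (hϱ : 0 < ϱ)
    (α : Fin d → ℕ) :
    ∃ C : ℝ, 0 ≤ C ∧ ∀ (U : Set (EuclideanSpace ℝ (Fin d))) (x₀ : EuclideanSpace ℝ (Fin d))
      (h : ℝ), IsStarShaped U x₀ ϱ h → ∀ (v : EuclideanSpace ℝ (Fin d) → ℝ)
      (q : MvPolynomial (Fin d) ℝ), MemSobolev U 1 1 v → IsEllipticProjection U l v q →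
      ∀ i, ∀ x ∈ U, h ^ (∑ j, α j) * |polyFun (polyDeriv (α + Pi.single i 1) q) x| *
        volume.real U ≤ C * ∑ i, ∫ x in U, |weakDeriv U (Pi.single i 1) v x| := by
  obtain ⟨C₀, hC₀, h₀⟩ := exists_sq_polyDeriv_le d l 0 hϱ
  obtain ⟨C₁, hC₁, h₁⟩ := exists_sq_polyDeriv_le d l α hϱ
  refine ⟨√(C₀ * C₁), Real.sqrt_nonneg _, fun U x₀ h hS v q hv hq i x hx => ?_⟩
  have hUo := hS.isOpen
  have hUm := hUo.measurableSet
  have hb := hS.isBounded hϱ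
  have hfin := hS.volume_ne_top hϱ
  have hV : 0 < volume.real U := ENNReal.toReal_pos (hS.volume_ne_zero hϱ) hfin
  have hdeg : ∀ i, (MvPolynomial.pderiv i q).totalDegree ≤ l := fun i =>
    (totalDegree_pderiv_le i q).trans hq.totalDegree_le
  have hI : ∀ i, IntegrableOn (weakDeriv U (Pi.single i 1) v) U := fun i =>
    hv.integrableOn_weakDeriv hUo hfin le_rfl (sum_single i).le
  set S : ℝ := ∑ i, ∫ x in U, polyFun (MvPolynomial.pderiv i q) x *
    polyFun (MvPolynomial.pderiv i q) x with hSdef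
  set W : ℝ := ∑ i, ∫ x in U, |weakDeriv U (Pi.single i 1) v x| with hW
  have hW0 : 0 ≤ W := Finset.sum_nonneg fun i _ => integral_nonneg fun x => abs_nonneg _
  have hSi : ∀ i, ∫ x in U, polyFun (MvPolynomial.pderiv i q) x *
      polyFun (MvPolynomial.pderiv i q) x ≤ S := fun i =>
    Finset.single_le_sum (f := fun i => ∫ x in U, polyFun (MvPolynomial.pderiv i q) x *
      polyFun (MvPolynomial.pderiv i q) x)
      (fun i _ => integral_nonneg fun x => mul_self_nonneg _) (Finset.mem_univ i)
  have hS0 : 0 ≤ S := Finset.sum_nonneg fun i _ => integral_nonneg fun x => mul_self_nonneg _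
  -- The inverse estimate of order zero, applied to the components of `∇q`.
  have hsup : ∀ i, ∀ x ∈ U, |polyFun (MvPolynomial.pderiv i q) x| ≤
      √(C₀ * S / volume.real U) := by
    intro i x hx
    refine Real.abs_le_sqrt ?_
    rw [le_div_iff₀ hV]
    have := h₀ U x₀ h hS.pos hUm hS.ball_subset (hS.subset_closedBall hϱ) _ (hdeg i) x hx
    simp only [Pi.zero_apply, Finset.sum_const_zero, pow_zero, one_mul, polyDeriv_zero] at this
    exact this.trans (mul_le_mul_of_nonneg_left (hSi i) hC₀)
  -- The projection equation is tested with `w = q`; pairing `L¹` with `L^∞` requires no more than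
  -- integrability of the weak gradient.
  have hSW : S ≤ W * √(C₀ * S / volume.real U) := by
    have e : S = ∑ i, ∫ x in U, weakDeriv U (Pi.single i 1) v x *
        polyFun (MvPolynomial.pderiv i q) x := by
      have h1 := hq.integral_grad_eq q hq.totalDegree_le
      rw [integral_sum_mul_polyFun hUm hb fun i => integrableOn_polyFun hUm hb _,
        integral_sum_mul_polyFun hUm hb hI] at h1
      exact h1
    refine e.trans_le ?_
    rw [hW, Finset.sum_mul]
    refine Finset.sum_le_sum fun i _ => ?_
    rw [← integral_mul_const]
    refine setIntegral_mono_on (integrableOn_mul_polyFun hUm hb (hI i) _)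
      ((hI i).abs.mul_const _) hUm fun x hx => ?_
    refine (le_abs_self _).trans ?_
    rw [abs_mul]
    exact mul_le_mul_of_nonneg_left (hsup i x hx) (abs_nonneg _)
  -- Squaring the previous bound leaves one factor `S` on the right; it is cancelled when `S > 0`.
  have hSV : S * volume.real U ≤ C₀ * W ^ 2 := by
    rcases hS0.eq_or_lt with h0 | h0
    · rw [← h0, zero_mul]; positivity
    · have h2 : S ^ 2 ≤ W ^ 2 * (C₀ * S / volume.real U) := by
        calc S ^ 2 ≤ (W * √(C₀ * S / volume.real U)) ^ 2 := by gcongr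
          _ = _ := by rw [mul_pow, Real.sq_sqrt (by positivity)]
      rw [← mul_div_assoc, le_div_iff₀ hV] at h2
      nlinarith
  -- A second inverse estimate, of order `α` on `∂ᵢ q`. One derivative already belongs to the
  -- gradient, hence the power `|α|` of `h` for a derivative of order `|α| + 1`.
  have h3 := h₁ U x₀ h hS.pos hUm hS.ball_subset (hS.subset_closedBall hϱ) _ (hdeg i) x hx
  rw [← polyDeriv_add_single] at h3
  refine abs_le_of_sq_le_sq' ?_ (by positivity) |>.2
  calc _ = (h ^ (∑ j, α j) * polyFun (polyDeriv (α + Pi.single i 1) q) x) ^ 2 *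
        volume.real U * volume.real U := by
        rw [mul_pow, mul_pow, sq_abs]; ring
    _ ≤ C₁ * S * volume.real U := by
        exact mul_le_mul_of_nonneg_right (h3.trans (mul_le_mul_of_nonneg_left (hSi i) hC₁)) hV.le
    _ = C₁ * (S * volume.real U) := by ring
    _ ≤ C₁ * (C₀ * W ^ 2) := by gcongr
    _ = _ := by rw [mul_pow, Real.sq_sqrt (by positivity)]; ring

end Stability

/-! ### Approximation estimates -/

section Estimates

theorem exists_eq_add_single {d : ℕ} {α : Fin d → ℕ} {m : ℕ} (hα : ∑ i, α i = m + 1) :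
    ∃ (β : Fin d → ℕ) (i : Fin d), α = β + Pi.single i 1 ∧ ∑ j, β j = m := by
  induction α using multiIndex_induction with
  | h0 => simp at hα
  | h1 β i _ => exact ⟨β, i, rfl, by rw [sum_add_single] at hα; omega⟩

/-- Stability of the elliptic projector in `L^p` seminorms of order at least one. -/
theorem exists_sum_eLpNorm_polyDeriv_le (d l m : ℕ) {ϱ : ℝ} (hϱ : 0 < ϱ) :
    ∃ C : ℝ, 0 ≤ C ∧ ∀ (U : Set (EuclideanSpace ℝ (Fin d))) (x₀ : EuclideanSpace ℝ (Fin d))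
      (h : ℝ), IsStarShaped U x₀ ϱ h → ∀ p : ℝ≥0∞, 1 ≤ p →
      ∀ (v : EuclideanSpace ℝ (Fin d) → ℝ) (q : MvPolynomial (Fin d) ℝ), MemSobolev U 1 p v →
      IsEllipticProjection U l v q →
      ENNReal.ofReal (h ^ m) * ∑ α ∈ Finset.piAntidiag Finset.univ (m + 1),
        eLpNorm (polyFun (polyDeriv α q)) p (volume.restrict U) ≤
        ENNReal.ofReal C * sobolevSeminorm U 1 p v := by
  choose C hC0 hC using fun β => exists_abs_polyDeriv_ellipticProjection_le d l hϱ β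
  set B : ℝ := ∑ β ∈ Finset.piAntidiag Finset.univ m, C β
  have hB : 0 ≤ B := Finset.sum_nonneg fun β _ => hC0 β
  set N : ℕ := (Finset.piAntidiag (Finset.univ : Finset (Fin d)) (m + 1)).card
  refine ⟨N * (B * d), by positivity, fun U x₀ h hS p hp v q hv hq => ?_⟩
  have hfin := hS.volume_ne_top hϱ
  have hU0 := hS.volume_ne_zero hϱ
  have hUo := hS.isOpen
  have hh := hS.pos
  have hV : 0 < volume.real U := ENNReal.toReal_pos hU0 hfin
  have i1 : IsFiniteMeasure (volume.restrict U) := ⟨by simpa using hfin.lt_top⟩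
  set W : ℝ := ∑ i, ∫ x in U, |weakDeriv U (Pi.single i 1) v x|
  have hW0 : 0 ≤ W := Finset.sum_nonneg fun i _ => integral_nonneg fun x => abs_nonneg _
  -- Hölder's inequality from `L^p` to `L¹`. For `p = ⊤` the conventions `p.toReal = 0` and `1 / 0 =
  -- 0` give the correct exponent `1`.
  have hW : ENNReal.ofReal W ≤
      d * sobolevSeminorm U 1 p v * volume U ^ (1 - 1 / p.toReal) := by
    rw [ENNReal.ofReal_sum_of_nonneg fun i _ => integral_nonneg fun x => abs_nonneg _]
    calc ∑ i, ENNReal.ofReal (∫ x in U, |weakDeriv U (Pi.single i 1) v x|)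
        ≤ ∑ i, eLpNorm (weakDeriv U (0 + Pi.single i 1) v) p (volume.restrict U) *
          volume U ^ (1 - 1 / p.toReal) := by
          refine Finset.sum_le_sum fun i _ => ?_
          rw [zero_add]
          have hi := hv.memLp hUo (sum_single i).le
          have h1 := eLpNorm_le_eLpNorm_mul_rpow_measure_univ hp hi.aestronglyMeasurable
          rw [Measure.restrict_apply_univ, ENNReal.toReal_one, one_div_one] at h1
          refine le_trans (le_of_eq ?_) h1
          rw [eLpNorm_one_eq_lintegral_enorm]
          exact ofReal_integral_norm_eq_lintegral_enorm
            (hv.integrableOn_weakDeriv hUo hfin hp (sum_single i).le)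
      _ ≤ _ := by
          rw [← Finset.sum_mul]
          gcongr
          exact sum_eLpNorm_le_sobolevSeminorm (by simp)
  have key : ∀ α ∈ Finset.piAntidiag (Finset.univ : Finset (Fin d)) (m + 1),
      ENNReal.ofReal (h ^ m) * eLpNorm (polyFun (polyDeriv α q)) p (volume.restrict U) ≤
        ENNReal.ofReal (B * d) * sobolevSeminorm U 1 p v := by
    intro α hα
    obtain ⟨β, i, rfl, hβ⟩ := exists_eq_add_single (mem_piAntidiag_univ.mp hα)
    have hCB : C β ≤ B := Finset.single_le_sum (f := C) (fun β _ => hC0 β)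
      (mem_piAntidiag_univ.mpr hβ)
    have hbound : ∀ x ∈ U, ‖polyFun (polyDeriv (β + Pi.single i 1) q) x‖ ≤
        B * W / (h ^ m * volume.real U) := by
      intro x hx
      have h1 := hC β U x₀ h hS v q (hv.mono_exponent hfin hp) hq i x hx
      rw [hβ] at h1
      rw [le_div_iff₀ (by positivity), Real.norm_eq_abs]
      calc _ = h ^ m * |polyFun (polyDeriv (β + Pi.single i 1) q) x| * volume.real U := by ring
        _ ≤ _ := h1
        _ ≤ _ := by gcongr
    have h2 := eLpNorm_le_of_ae_bound (p := p) (μ := volume.restrict U)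
      ((ae_restrict_iff' hUo.measurableSet).mpr (Filter.Eventually.of_forall hbound))
    rw [Measure.restrict_apply_univ] at h2
    have h3 : ENNReal.ofReal (h ^ m) * ENNReal.ofReal (B * W / (h ^ m * volume.real U)) =
        ENNReal.ofReal B * ENNReal.ofReal W / volume U := by
      rw [← ENNReal.ofReal_mul (by positivity), ← ENNReal.ofReal_mul hB,
        ← ENNReal.ofReal_toReal hfin, ← measureReal_def, ← ENNReal.ofReal_div_of_pos hV]
      congr 1
      field_simp
    -- The factor `|U| ^ (1 / p)` from the norm of a constant and the factor from Hölder's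
    -- inequality combine to `|U|`, which cancels the mean value; no power of the volume remains.
    have h4 : volume U ^ p.toReal⁻¹ * volume U ^ (1 - 1 / p.toReal) = volume U := by
      rw [← ENNReal.rpow_add _ _ hU0 hfin, one_div, add_sub_cancel, ENNReal.rpow_one]
    calc _ ≤ ENNReal.ofReal (h ^ m) * (volume U ^ p.toReal⁻¹ *
          ENNReal.ofReal (B * W / (h ^ m * volume.real U))) := by gcongr
      _ = volume U ^ p.toReal⁻¹ * (ENNReal.ofReal (h ^ m) *
          ENNReal.ofReal (B * W / (h ^ m * volume.real U))) := by ring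
      _ ≤ volume U ^ p.toReal⁻¹ * (ENNReal.ofReal B *
          (d * sobolevSeminorm U 1 p v * volume U ^ (1 - 1 / p.toReal)) / volume U) := by
          rw [h3]; gcongr
      _ = ENNReal.ofReal B * d * sobolevSeminorm U 1 p v *
          ((volume U ^ p.toReal⁻¹ * volume U ^ (1 - 1 / p.toReal)) / volume U) := by
          simp only [div_eq_mul_inv]; ring
      _ = _ := by
          rw [h4, ENNReal.div_self hU0 hfin, mul_one, ENNReal.ofReal_mul hB, ENNReal.ofReal_natCast]
  rw [Finset.mul_sum]
  refine (Finset.sum_le_card_nsmul _ _ _ key).trans (le_of_eq ?_)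
  rw [nsmul_eq_mul, ENNReal.ofReal_mul (p := (N : ℝ)) (by positivity), ENNReal.ofReal_natCast,
    mul_assoc]

variable {U : Set (EuclideanSpace ℝ (Fin d))} {s : ℕ} {p : ℝ≥0∞}
  {v : EuclideanSpace ℝ (Fin d) → ℝ}

theorem MemSobolev.sobolevSeminorm_sub_polyFun_le (hU : IsOpen U) (hp : 1 ≤ p)
    (hv : MemSobolev U s p v) {m : ℕ} (hm : m ≤ s) (q : MvPolynomial (Fin d) ℝ) :
    sobolevSeminorm U m p (v - polyFun q) ≤ sobolevSeminorm U m p v +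
      ∑ α ∈ Finset.piAntidiag Finset.univ m,
        eLpNorm (polyFun (polyDeriv α q)) p (volume.restrict U) := by
  unfold sobolevSeminorm
  rw [← Finset.sum_add_distrib]
  refine Finset.sum_le_sum fun α hα => ?_
  have hα' : ∑ i, α i ≤ s := (mem_piAntidiag_univ.mp hα).le.trans hm
  rw [eLpNorm_congr_ae (hv.weakDeriv_sub_polyFun_ae_eq hU hα' q)]
  exact eLpNorm_sub_le (hv.memLp hU hα').aestronglyMeasurable
    (polyFun_continuous _).aestronglyMeasurable hp

/-- `Q` plays the role of an averaged Taylor polynomial: its derivatives have the same means as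
those of `v` below order `s`, and they vanish at order `s`, so the top seminorm does not grow. -/
theorem MemSobolev.exists_polynomial_integral_eq_zero (hU : IsOpen U) (hne : U.Nonempty)
    (hb : Bornology.IsBounded U) (hp : 1 ≤ p) (hv : MemSobolev U s p v) :
    ∃ Q : MvPolynomial (Fin d) ℝ, Q.totalDegree ≤ s - 1 ∧
      (∀ α : Fin d → ℕ, ∑ i, α i < s → ∫ x in U, weakDeriv U α (v - polyFun Q) x = 0) ∧
      sobolevSeminorm U s p (v - polyFun Q) ≤ sobolevSeminorm U s p v := by
  have hfin := hb.measure_lt_top (μ := volume).ne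
  obtain ⟨Q, hQdeg, hQ0, hQ⟩ := exists_polynomial_integral_polyDeriv_eq hU.measurableSet hb
    (hU.measure_pos volume hne).ne' s fun α => ∫ x in U, weakDeriv U α v x
  refine ⟨Q, hQdeg, fun α hα => ?_, ?_⟩
  · rw [integral_congr_ae (hv.weakDeriv_sub_polyFun_ae_eq hU hα.le Q)]
    simp only [Pi.sub_apply]
    rw [integral_sub (hv.integrableOn_weakDeriv hU hfin hp hα.le)
      (integrableOn_polyFun hU.measurableSet hb _), hQ α hα, sub_self]
  · refine (hv.sobolevSeminorm_sub_polyFun_le hU hp le_rfl Q).trans (le_of_eq ?_)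
    rw [Finset.sum_eq_zero, add_zero]
    intro α hα
    rw [hQ0 α (mem_piAntidiag_univ.mp hα), polyFun_zero, eLpNorm_zero]

/-- The approximation estimate for the elliptic projector in seminorms of order at least one. -/
theorem exists_sobolevSeminorm_succ_sub_ellipticProjection_le (d l : ℕ) {ϱ : ℝ} (hϱ : 0 < ϱ)
    (m k : ℕ) (hs : m + k ≤ l) :
    ∃ C : ℝ, 0 ≤ C ∧ ∀ (U : Set (EuclideanSpace ℝ (Fin d))) (x₀ : EuclideanSpace ℝ (Fin d))
      (h : ℝ), IsStarShaped U x₀ ϱ h → ∀ p : ℝ≥0∞, 1 ≤ p →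
      ∀ (v : EuclideanSpace ℝ (Fin d) → ℝ) (q : MvPolynomial (Fin d) ℝ),
      MemSobolev U (m + 1 + k) p v → IsEllipticProjection U l v q →
      sobolevSeminorm U (m + 1) p (v - polyFun q) ≤
        ENNReal.ofReal (C * h ^ k) * sobolevSeminorm U (m + 1 + k) p v := by
  obtain ⟨A, hA, hAle⟩ := exists_sobolevSeminorm_le d hϱ k (m + 1)
  obtain ⟨A', hA', hAle'⟩ := exists_sobolevSeminorm_le d hϱ (m + k) 1
  obtain ⟨C, hC, hCle⟩ := exists_sum_eLpNorm_polyDeriv_le d l m hϱ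
  have e : 1 + (m + k) = m + 1 + k := by ring
  rw [e] at hAle'
  refine ⟨A + C * A', by positivity, fun U x₀ h hS p hp v q hv hq => ?_⟩
  have hh := hS.pos
  have hUo := hS.isOpen
  have hb := hS.isBounded hϱ
  obtain ⟨Q, hQdeg, hmean, hsemi⟩ :=
    hv.exists_polynomial_integral_eq_zero hUo ⟨x₀, hS.mem hϱ⟩ hb hp
  set w := v - polyFun Q with hwdef
  have hw : MemSobolev U (m + 1 + k) p w := hv.sub_polyFun hUo hb Q
  -- Here `Q` has degree at most `m + k ≤ l`, so the projector reproduces it.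
  have hr : IsEllipticProjection U l w (q - Q) :=
    hq.sub_polyFun hUo hb ((hv.mono (by omega)).mono_exponent (hS.volume_ne_top hϱ) hp) (by omega)
  have hvq : v - polyFun q = w - polyFun (q - Q) := by
    rw [hwdef, polyFun_sub]; abel
  have h1 := hAle U x₀ h hS p hp w hw hmean
  have h2 := hCle U x₀ h hS p hp w (q - Q) (hw.mono (by omega)) hr
  have h3 := hAle' U x₀ h hS p hp w hw hmean
  -- Stability loses `h ^ m`, while Poincaré from order `1` to order `m + 1 + k` gains `h ^ (m +
  -- k)`; the net gain is `h ^ k`.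
  have h4 : ∑ α ∈ Finset.piAntidiag Finset.univ (m + 1),
      eLpNorm (polyFun (polyDeriv α (q - Q))) p (volume.restrict U) ≤
      ENNReal.ofReal (C * A' * h ^ k) * sobolevSeminorm U (m + 1 + k) p w := by
    have h5 := h2.trans (mul_le_mul_right h3 _)
    rw [← ENNReal.mul_le_mul_iff_right (a := ENNReal.ofReal (h ^ m)) (by positivity)
      ENNReal.ofReal_ne_top]
    refine h5.trans (le_of_eq ?_)
    rw [← mul_assoc, ← mul_assoc, ← ENNReal.ofReal_mul hC, ← ENNReal.ofReal_mul (by positivity)]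
    congr 2
    ring
  rw [hvq]
  calc _ ≤ _ := hw.sobolevSeminorm_sub_polyFun_le hUo hp (by omega) _
    _ ≤ _ := add_le_add h1 h4
    _ = ENNReal.ofReal ((A + C * A') * h ^ k) * sobolevSeminorm U (m + 1 + k) p w := by
        rw [← add_mul, ← ENNReal.ofReal_add (by positivity) (by positivity), add_mul]
    _ ≤ _ := by gcongr

/-- The approximation estimate for the elliptic projector in `L^p`. -/
theorem exists_sobolevSeminorm_zero_sub_ellipticProjection_le (d l : ℕ) {ϱ : ℝ} (hϱ : 0 < ϱ)
    (k : ℕ) (hs : k ≤ l) :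
    ∃ C : ℝ, 0 ≤ C ∧ ∀ (U : Set (EuclideanSpace ℝ (Fin d))) (x₀ : EuclideanSpace ℝ (Fin d))
      (h : ℝ), IsStarShaped U x₀ ϱ h → ∀ p : ℝ≥0∞, 1 ≤ p →
      ∀ (v : EuclideanSpace ℝ (Fin d) → ℝ) (q : MvPolynomial (Fin d) ℝ),
      MemSobolev U (k + 1) p v → IsEllipticProjection U l v q →
      sobolevSeminorm U 0 p (v - polyFun q) ≤
        ENNReal.ofReal (C * h ^ (k + 1)) * sobolevSeminorm U (k + 1) p v := by
  obtain ⟨A, hA, hAle⟩ := exists_sobolevSeminorm_le d hϱ 1 0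
  obtain ⟨C, hC, hCle⟩ := exists_sobolevSeminorm_succ_sub_ellipticProjection_le d l hϱ 0 k
    (by omega)
  have e : 0 + 1 + k = k + 1 := by ring
  rw [e] at hCle
  rw [zero_add] at hAle hCle
  refine ⟨A * C, by positivity, fun U x₀ h hS p hp v q hv hq => ?_⟩
  have hh := hS.pos
  have hu := hv.sub_polyFun hS.isOpen (hS.isBounded hϱ) q
  -- A single Poincaré step requires zero mean for `α = 0` only, and this is the normalisation in
  -- the definition of the projector.
  have h1 := hAle U x₀ h hS p hp (v - polyFun q) (hu.mono (by omega)) fun α hα => by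
    have hα0 : α = 0 := by
      ext i
      exact (Finset.sum_eq_zero_iff.mp (Nat.lt_one_iff.mp hα)) i (Finset.mem_univ i)
    rw [hα0, integral_congr_ae (hu.weakDeriv_zero_ae_eq hS.isOpen)]
    have h0 := hq.integral_sub_eq_zero
    simp only [Pi.sub_apply]
    rw [← neg_eq_zero, ← integral_neg]
    simpa using h0
  refine h1.trans ((mul_le_mul_right (hCle U x₀ h hS p hp v q hv hq) _).trans (le_of_eq ?_))
  rw [← mul_assoc, ← ENNReal.ofReal_mul (by positivity)]
  congr 2
  ring

theorem isEllipticProjection_ellipticProjector {l : ℕ}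
    (h : ∃ q, IsEllipticProjection U l v q) :
    IsEllipticProjection U l v (ellipticProjector U l v) := by
  unfold ellipticProjector
  rw [dif_pos h]
  exact h.choose_spec

/-- An open set contains a short segment in the first coordinate direction; in dimension zero the
diameter would be `0`. -/
theorem diam_pos_of_isOpen (hd : 1 ≤ d) (hU : IsOpen U) (hb : Bornology.IsBounded U)
    (hne : U.Nonempty) : 0 < Metric.diam U := by
  obtain ⟨x, hx⟩ := hne
  obtain ⟨ε, hε, hball⟩ := Metric.isOpen_iff.mp hU x hx
  have hdist : dist (x + EuclideanSpace.single (⟨0, hd⟩ : Fin d) (ε / 2)) x = ε / 2 := by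
    rw [dist_eq_norm, add_sub_cancel_left, EuclideanSpace.single, PiLp.norm_single,
      Real.norm_of_nonneg (by positivity)]
  have hmem : x + EuclideanSpace.single (⟨0, hd⟩ : Fin d) (ε / 2) ∈ U :=
    hball (by rw [Metric.mem_ball, hdist]; linarith)
  have := Metric.dist_le_diam_of_mem hb hmem hx
  linarith

end Estimates

end EllipticProj

end

/-! ### The approximation theorem -/

theorem theorem1 (d : ℕ) (hd : 1 ≤ d) (ϱ : ℝ) (hϱ : 0 < ϱ) (l s : ℕ) (hs : 1 ≤ s)
    (hsl : s ≤ l + 1) (p : ℝ≥0∞) (hp : 1 ≤ p) :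
    ∃ C : ℝ, 0 < C ∧
      ∀ U : Set (EuclideanSpace ℝ (Fin d)),
        IsOpen U → Bornology.IsBounded U → IsConnected U →
        (∃ x₀ : EuclideanSpace ℝ (Fin d), Metric.ball x₀ (ϱ * Metric.diam U) ⊆ U ∧
          ∀ y ∈ Metric.ball x₀ (ϱ * Metric.diam U), StarConvex ℝ y U) →
        (∀ v : EuclideanSpace ℝ (Fin d) → ℝ, EllipticProj.MemSobolev U 1 1 v →
          ∃! q : MvPolynomial (Fin d) ℝ, EllipticProj.IsEllipticProjection U l v q) ∧
        ∀ v : EuclideanSpace ℝ (Fin d) → ℝ, EllipticProj.MemSobolev U s p v →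
          EllipticProj.MemSobolev U s p
            (v - EllipticProj.polyFun (EllipticProj.ellipticProjector U l v)) ∧
          ∀ m : ℕ, m ≤ s →
            EllipticProj.sobolevSeminorm U m p
                (v - EllipticProj.polyFun (EllipticProj.ellipticProjector U l v)) ≤
              ENNReal.ofReal (C * Metric.diam U ^ (s - m)) *
                EllipticProj.sobolevSeminorm U s p v := by
  open EllipticProj in
  have hex : ∀ m : ℕ, ∃ C : ℝ, 0 ≤ C ∧ (m ≤ s →
      ∀ (U : Set (EuclideanSpace ℝ (Fin d))) (x₀ : EuclideanSpace ℝ (Fin d))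
      (h : ℝ), IsStarShaped U x₀ ϱ h →
      ∀ (v : EuclideanSpace ℝ (Fin d) → ℝ) (q : MvPolynomial (Fin d) ℝ),
      MemSobolev U s p v → IsEllipticProjection U l v q →
      sobolevSeminorm U m p (v - polyFun q) ≤
        ENNReal.ofReal (C * h ^ (s - m)) * sobolevSeminorm U s p v) := by
    intro m
    by_cases hm : m ≤ s
    swap
    -- Orders above `s` receive a dummy constant, so that a constant can be chosen as a function of
    -- `m`.
    · exact ⟨0, le_rfl, fun h => absurd h hm⟩
    rcases m with _ | m
    · obtain ⟨k, rfl⟩ : ∃ k, s = k + 1 := ⟨s - 1, by omega⟩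
      obtain ⟨C, hC, hCle⟩ :=
        exists_sobolevSeminorm_zero_sub_ellipticProjection_le d l hϱ k (by omega)
      exact ⟨C, hC, fun _ U x₀ h hS v q hv hq => hCle U x₀ h hS p hp v q hv hq⟩
    · obtain ⟨k, rfl⟩ : ∃ k, s = m + 1 + k := ⟨s - (m + 1), by omega⟩
      obtain ⟨C, hC, hCle⟩ :=
        exists_sobolevSeminorm_succ_sub_ellipticProjection_le d l hϱ m k (by omega)
      refine ⟨C, hC, fun _ U x₀ h hS v q hv hq => ?_⟩
      rw [Nat.add_sub_cancel_left]
      exact hCle U x₀ h hS p hp v q hv hq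
  choose C hC hCle using hex
  -- The sum dominates the constants of all orders `m ≤ s` at once, and the summand `1` makes it
  -- positive.
  refine ⟨1 + ∑ m ∈ Finset.range (s + 1), C m,
    add_pos_of_pos_of_nonneg one_pos (Finset.sum_nonneg fun m _ => hC m), ?_⟩
  rintro U hU hb hconn ⟨x₀, hball, hstar⟩
  have hne := hconn.nonempty
  have hfin := hb.measure_lt_top (μ := MeasureTheory.volume).ne
  have hS : EllipticProj.IsStarShaped U x₀ ϱ (Metric.diam U) :=
    ⟨hU, EllipticProj.diam_pos_of_isOpen hd hU hb hne, hball, hstar,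
      fun x hx y hy => Metric.dist_le_diam_of_mem hb hx hy⟩
  have huniq : ∀ v : EuclideanSpace ℝ (Fin d) → ℝ, EllipticProj.MemSobolev U 1 1 v →
      ∃! q : MvPolynomial (Fin d) ℝ, EllipticProj.IsEllipticProjection U l v q := fun v hv =>
    EllipticProj.existsUnique_isEllipticProjection hU hne hb l
      (hv.integrableOn hU hfin le_rfl)
      fun i => hv.integrableOn_weakDeriv hU hfin le_rfl (EllipticProj.sum_single i).le
  refine ⟨huniq, fun v hv => ⟨hv.sub_polyFun hU hb _, fun m hm => ?_⟩⟩
  -- As `s ≥ 1`, `p ≥ 1` and `U` has finite measure, `v` lies in `W^{1,1}(U)`; the projector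
  -- therefore takes its genuine value and not the default `0`.
  have hq := EllipticProj.isEllipticProjection_ellipticProjector
    (huniq v ((hv.mono hs).mono_exponent hfin hp)).exists
  refine (hCle m hm U x₀ _ hS v _ hv hq).trans ?_
  have hpos := hS.pos.le
  gcongr
  have := Finset.single_le_sum (f := C) (fun m _ => hC m)
    (Finset.mem_range.mpr (Nat.lt_succ_of_le hm))
  linarith
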